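/- A positive Markov process $X$ is a $[0,\infty]$-valued process $(X_t)_{t\in[0,\infty)}$ on a measurable space carrying probabilities $(\mathbb P_x)_{x\in[0,\infty]}$ such that, $\mathcal B_{[0,\infty]}$ denoting the Borel sets of $[0,\infty]$: $x\mapsto \mathbb P_x(X_t\in A)$ is Borel for all $t\in[0,\infty)$ and $A\in\mathcal B_{[0,\infty]}$; $\mathbb P_x(X_0=x)=1$ for all $x\in[0,\infty]$; and $\mathbb P_x(X_t\in A\mid\sigma(X_u:u\in[0,s]))=\mathbb P_{X_s}(X_{t-s}\in A)$ $\mathbb P_x$-a.s. for all $0\le s\le t<\infty$, $A\in\mathcal B_{[0,\infty]}$, $x\in[0,\infty]$. (No path regularity is assumed.) Let $p_t(x,\cdot)$ be the law of $X_t$ under $\mathbb P_x$, and $P_tf(x)=\int f(u)\,p_t(x,\mathrm du)$ for bounded measurable $f:[0,\infty]\to\mathbb R$. Expectations under $\mathbb P_x$ are written $\mathbb E_x$; for a second positive Markov process $Y$ the probabilities and expectations are written $\mathbb P^y$, $\mathbb E^y$, $y\in[0,\infty]$. Let $\mathsf{cm}$ be the class of nonincreasing maps $f:[0,\infty]\to[0,\infty)$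 whose restriction to $(0,\infty)$ is completely monotone, i.e. $C^\infty$ with $(-1)^nf^{(n)}\ge 0$ for all $n\ge 0$. For a positive Markov process $X$: - $X$ is *completely monotone* if $P_t\mathsf{cm}\subset\mathsf{cm}$ for all $t\in[0,\infty)$; - $x\in\{0,\infty\}$ is *absorbing* for $X$ if $p_t(x,\cdot)=\delta_x$ for all $t\in[0,\infty)$; - $X$ is *weakly continuous at* $x\in[0,\infty]$ if $P_tf$ is continuous at $x$ for all $t\in[0,\infty)$ and all continuous $f:[0,\infty]\to\mathbb R$; - $X$ is *weakly-$[0,\infty)$ continuous at $0$* if $\mathbb E_x[f(X_t);X_t<\infty]\to\mathbb E_0[f(X_t);X_t<\infty]$ as $x\downarrow0$, for all $t\in[0,\infty)$ and all continuous $f:[0,\infty]\to\mathbb R$; - $X$ is *weakly-$(0,\infty]$ continuous at $\infty$* if $\mathbb E_x[f(X_t);X_t>0]\to\mathbb E_\infty[f(X_t);X_t>0]$ as $x\uparrow\infty$, for all $t\in[0,\infty)$ and all continuous $f:[0,\infty]\to\mathbb R$. In interpreting $e^{-xy}$ for $(x,y)\in[0,\infty]^2$ put $e^{-\infty}=0$,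 $x\cdot\infty=\infty\cdot x=\infty$ for $x\in(0,\infty]$, and use one of two conventions for $0\cdot\infty$ (that is, $x=0$, $y=\infty$): $0^+\cdot\infty:=\infty$ or $0\cdot\infty^-:=0$; and, independently, one of two conventions for $\infty\cdot0$ (that is, $x=\infty$, $y=0$): $\infty\cdot0^+:=\infty$ or $\infty^-\cdot0:=0$. For a choice $\star_1\in\{0^+\cdot\infty,\,0\cdot\infty^-\}$, $\star_2\in\{\infty\cdot0^+,\,\infty^-\cdot0\}$, say that $X$ is in $(\star_1,\star_2)$-Laplace duality with $Y$ if $$\mathbb E_x[e^{-X_ty}]=\mathbb E^y[e^{-xY_t}],\qquad t\in[0,\infty),\ (x,y)\in[0,\infty]^2,$$ under the conventions $\star_1,\star_2$. **Theorem.** Let $X$ be a positive Markov process. (i) $X$ is in $(0^+\cdot\infty,\infty\cdot0^+)$-Laplace duality with some positive Markov process $Y$ if and only if $X$ is completely monotone, weakly-$[0,\infty)$ continuous at $0$, and has $\infty$ absorbing. In that case every such $Y$ is also completely monotone, weakly-$[0,\infty)$ continuous at $0$, and has $\infty$ absorbing; moreover, under $0^+\cdot\infty$, $\infty\cdot0^+$,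 for all $(x,y)\in[0,\infty]^2$ and $t\in[0,\infty)$, $$\mathbb E_0[e^{-X_ty}]=\mathbb P^y(Y_t<\infty)\quad\text{and}\quad\mathbb P_x(X_t<\infty)=\mathbb E^0[e^{-xY_t}].$$ (ii) $X$ is in $(0\cdot\infty^-,\infty^-\cdot0)$-Laplace duality with some positive Markov process $Y$ if and only if $X$ is completely monotone, weakly-$(0,\infty]$ continuous at $\infty$, and has $0$ absorbing. In that case every such $Y$ is also completely monotone, weakly-$(0,\infty]$ continuous at $\infty$, and has $0$ absorbing; moreover, under $0\cdot\infty^-$, $\infty^-\cdot0$, for all $(x,y)\in[0,\infty]^2$ and $t\in[0,\infty)$, $$\mathbb E_\infty[e^{-X_ty}]=\mathbb P^y(Y_t=0)\quad\text{and}\quad\mathbb P_x(X_t=0)=\mathbb E^\infty[e^{-xY_t}].$$ (iii) $X$ is in $(0\cdot\infty^-,\infty\cdot0^+)$-Laplace duality with some positive Markov process $Y$ if and only if $X$ is completely monotone and has $0$ and $\infty$ both absorbing. In that case every such $Y$ is completely monotone and weakly continuous at $0$ and at $\infty$; moreover, under $0\cdot\infty^-$, $\infty\cdot0^+$, for all $x\in[0,\infty]$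 and $t\in[0,\infty)$, $$\mathbb P_x(X_t<\infty)=\mathbb E^0[e^{-xY_t}]\quad\text{and}\quad\mathbb P_x(X_t=0)=\mathbb E^\infty[e^{-xY_t}].$$ (iv) $X$ is in $(0^+\cdot\infty,\infty^-\cdot0)$-Laplace duality with some positive Markov process $Y$ if and only if $X$ is completely monotone and weakly continuous at both $0$ and $\infty$. In that case every such $Y$ is completely monotone and has $0$ and $\infty$ both absorbing; moreover, under $0^+\cdot\infty$, $\infty^-\cdot0$, for all $y\in[0,\infty]$ and $t\in[0,\infty)$, $$\mathbb E_0[e^{-X_ty}]=\mathbb P^y(Y_t<\infty)\quad\text{and}\quad\mathbb E_\infty[e^{-X_ty}]=\mathbb P^y(Y_t=0).$$ -/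

import Mathlib

open MeasureTheory ProbabilityTheory Set Filter Topology
open scoped ENNReal NNReal

universe u v

noncomputable section

/-- A positive Markov process: a `[0,∞]`-valued process `(X_t)`, `t ∈ [0,∞)`, on a measurable space
`Ω`, under a family of probabilities `(P_x)`, `x ∈ [0,∞]`, that is measurable in the starting point,
normal and Markov with respect to its own past. No path regularity is required. -/
structure PositiveMarkovProcess : Type (u + 1) where
  /-- the common measurable space -/
  Ω : Type u
  mΩ : MeasurableSpace Ω
  /-- the process -/
  X : ℝ≥0 → Ω → ℝ≥0∞
  /-- the law under which the process is issued from a given point -/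
  P : ℝ≥0∞ → Measure Ω
  isProb : ∀ x, IsProbabilityMeasure (P x)
  measurable_X : ∀ t, Measurable (X t)
  measurable_P : ∀ t, ∀ A : Set ℝ≥0∞, MeasurableSet A → Measurable fun x => P x (X t ⁻¹' A)
  normal : ∀ x, P x {ω | X 0 ω = x} = 1
  markov : ∀ s t : ℝ≥0, s ≤ t → ∀ A : Set ℝ≥0∞, MeasurableSet A → ∀ x,
    (P x)⟦X t ⁻¹' A | ⨆ u ∈ Set.Iic s, MeasurableSpace.comap (X u) inferInstance⟧
      =ᵐ[P x] fun ω => (P (X s ω)).real (X (t - s) ⁻¹' A)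

namespace PositiveMarkovProcess

instance (Z : PositiveMarkovProcess) : MeasurableSpace Z.Ω := Z.mΩ

instance (Z : PositiveMarkovProcess) (x : ℝ≥0∞) : IsProbabilityMeasure (Z.P x) := Z.isProb x

/-- The transition law `p_t(x, ·)`: the law of `X_t` under `P_x`. -/
def trans (Z : PositiveMarkovProcess) (t : ℝ≥0) (x : ℝ≥0∞) : Measure ℝ≥0∞ :=
  (Z.P x).map (Z.X t)

/-- The transition semigroup `P_t f (x) = ∫ f(u) p_t(x, du)`
(used for bounded measurable `f` only). -/
def semigroup (Z : PositiveMarkovProcess) (t : ℝ≥0) (f : ℝ≥0∞ → ℝ) (x : ℝ≥0∞) : ℝ :=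
  ∫ u, f u ∂(Z.trans t x)

end PositiveMarkovProcess

/-- The class `cm` of decreasing maps `f : [0,∞] → [0,∞)` whose restriction to `(0,∞)` is
completely monotone, i.e. `C^∞` with `(-1)^n f^{(n)} ≥ 0` for all `n`. -/
structure IsCM (f : ℝ≥0∞ → ℝ) : Prop where
  antitone : Antitone f
  nonneg : ∀ u, 0 ≤ f u
  smooth : ContDiffOn ℝ (⊤ : ℕ∞) (fun r : ℝ => f (ENNReal.ofReal r)) (Ioi 0)
  alternating : ∀ n : ℕ, ∀ r : ℝ, 0 < r →
    0 ≤ (-1 : ℝ) ^ n * iteratedDerivWithin n (fun r : ℝ => f (ENNReal.ofReal r)) (Ioi 0) r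

/-- The two conventions for `0 · ∞` (left factor `0`, right factor `∞`) in `e^{-0·∞}`. -/
inductive ZeroTimesTop
  /-- `0⁺ · ∞ = lim_{ε ↓ 0} ε · ∞ = ∞` -/
  | zeroPlus
  /-- `0 · ∞⁻ = lim_{n ↑ ∞} 0 · n = 0` -/
  | topMinus

/-- The two conventions for `∞ · 0` (left factor `∞`, right factor `0`) in `e^{-∞·0}`. -/
inductive TopTimesZero
  /-- `∞ · 0⁺ = lim_{ε ↓ 0} ∞ · ε = ∞` -/
  | zeroPlus
  /-- `∞⁻ · 0 = lim_{n ↑ ∞} n · 0 = 0` -/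
  | topMinus

/-- The value of `0 · ∞` under a convention. -/
def ZeroTimesTop.val : ZeroTimesTop → ℝ≥0∞
  | .zeroPlus => ∞
  | .topMinus => 0

/-- The value of `∞ · 0` under a convention. -/
def TopTimesZero.val : TopTimesZero → ℝ≥0∞
  | .zeroPlus => ∞
  | .topMinus => 0

open Classical in
/-- The product `x · y` in `[0,∞]` under the conventions `c₁` for `0 · ∞` and `c₂` for `∞ · 0`. -/
def convMul (c₁ : ZeroTimesTop) (c₂ : TopTimesZero) (x y : ℝ≥0∞) : ℝ≥0∞ :=
  if x = 0 ∧ y = ∞ then c₁.val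
  else if x = ∞ ∧ y = 0 then c₂.val
  else x * y

open Classical in
/-- `e^{-z}` for `z ∈ [0,∞]`, with `e^{-∞} = 0`. -/
def expNeg (z : ℝ≥0∞) : ℝ := if z = ∞ then 0 else Real.exp (-z.toReal)

/-- The kernel `(x, y) ↦ e^{-xy}` on `[0,∞]²` under the given conventions. -/
def expKernel (c₁ : ZeroTimesTop) (c₂ : TopTimesZero) (x y : ℝ≥0∞) : ℝ :=
  expNeg (convMul c₁ c₂ x y)

namespace PositiveMarkovProcess

/-- `X` is in `(c₁, c₂)`-Laplace duality with `Y`: `E_x[e^{-X_t y}] = E^y[e^{-x Y_t}]` for all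
`t ∈ [0,∞)` and `x, y ∈ [0,∞]`. -/
def LaplaceDual (c₁ : ZeroTimesTop) (c₂ : TopTimesZero) (X Y : PositiveMarkovProcess) : Prop :=
  ∀ (t : ℝ≥0) (x y : ℝ≥0∞),
    ∫ ω, expKernel c₁ c₂ (X.X t ω) y ∂(X.P x) = ∫ ω, expKernel c₁ c₂ x (Y.X t ω) ∂(Y.P y)

/-- The semigroup leaves the class `cm` invariant. -/
def CompletelyMonotone (Z : PositiveMarkovProcess) : Prop :=
  ∀ (t : ℝ≥0) (f : ℝ≥0∞ → ℝ), IsCM f → IsCM (Z.semigroup t f)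

/-- The point `x` is absorbing: `p_t(x, ·) = δ_x` for all `t`. -/
def Absorbing (Z : PositiveMarkovProcess) (x : ℝ≥0∞) : Prop :=
  ∀ t : ℝ≥0, Z.trans t x = Measure.dirac x

/-- Weak continuity at `x`: `P_t f` is continuous at `x` for all continuous `f : [0,∞] → ℝ`. -/
def WeaklyContinuousAt (Z : PositiveMarkovProcess) (x : ℝ≥0∞) : Prop :=
  ∀ (t : ℝ≥0) (f : ℝ≥0∞ → ℝ), Continuous f → ContinuousAt (Z.semigroup t f) x

/-- Weak-`[0,∞)` continuity at `0`: `E_x[f(X_t); X_t < ∞] → E_0[f(X_t); X_t < ∞]` as `x ↓ 0`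
for all continuous `f : [0,∞] → ℝ`. -/
def WeaklyContinuousAtZero (Z : PositiveMarkovProcess) : Prop :=
  ∀ (t : ℝ≥0) (f : ℝ≥0∞ → ℝ), Continuous f →
    Tendsto (fun x => ∫ ω in {ω | Z.X t ω < ∞}, f (Z.X t ω) ∂(Z.P x)) (𝓝[>] 0)
      (𝓝 (∫ ω in {ω | Z.X t ω < ∞}, f (Z.X t ω) ∂(Z.P 0)))

/-- Weak-`(0,∞]` continuity at `∞`: `E_x[f(X_t); X_t > 0] → E_∞[f(X_t); X_t > 0]` as `x ↑ ∞`
for all continuous `f : [0,∞] → ℝ`. -/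
def WeaklyContinuousAtTop (Z : PositiveMarkovProcess) : Prop :=
  ∀ (t : ℝ≥0) (f : ℝ≥0∞ → ℝ), Continuous f →
    Tendsto (fun x => ∫ ω in {ω | 0 < Z.X t ω}, f (Z.X t ω) ∂(Z.P x)) (𝓝[<] ∞)
      (𝓝 (∫ ω in {ω | 0 < Z.X t ω}, f (Z.X t ω) ∂(Z.P ∞)))

end PositiveMarkovProcess

end

section KolmogorovExtension

variable {ι E : Type*} [TopologicalSpace E] [CompactSpace E] [TopologicalSpace.PseudoMetrizableSpace E]
  [SecondCountableTopology E] [MeasurableSpace E] [BorelSpace E]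
  {P : ∀ J : Finset ι, Measure (J → E)} [∀ J, IsFiniteMeasure (P J)]

/-- A measurable cylinder contains a closed cylinder of almost the same content. -/
lemma exists_isClosed_projectiveFamilyContent_sdiff_lt
    (hP : IsProjectiveMeasureFamily (α := fun _ : ι => E) P) {A : Set (ι → E)}
    (hA : A ∈ measurableCylinders fun _ : ι => E) {ε : ℝ≥0∞} (hε : ε ≠ 0) :
    ∃ K ∈ measurableCylinders fun _ : ι => E, K ⊆ A ∧ IsClosed K ∧
      projectiveFamilyContent hP (A \ K) < ε := by
  obtain ⟨s, S, hS, rfl⟩ := (mem_measurableCylinders _).1 hA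
  obtain ⟨F, hFS, hF, hlt⟩ := hS.exists_isClosed_sdiff_lt (μ := P s) (measure_ne_top _ _) hε
  refine ⟨cylinder s F, cylinder_mem_measurableCylinders _ _ hF.measurableSet,
    preimage_mono hFS, IsClosed.cylinder s hF, ?_⟩
  rwa [sdiff_cylinder_same, projectiveFamilyContent_cylinder hP (hS.diff hF.measurableSet)]

lemma projectiveFamilyContent_tendsto_zero
    (hP : IsProjectiveMeasureFamily (α := fun _ : ι => E) P) {A : ℕ → Set (ι → E)}
    (hA : ∀ n, A n ∈ measurableCylinders fun _ : ι => E) (hanti : Antitone A)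
    (hinter : ⋂ n, A n = ∅) :
    Tendsto (fun n => projectiveFamilyContent hP (A n)) atTop (𝓝 0) := by
  rw [ENNReal.tendsto_nhds_zero]
  intro ε hε
  obtain ⟨δ, hδ, hsum⟩ := ENNReal.exists_pos_sum_of_countable' hε.ne' ℕ
  choose K hKmem hKA hKc hK using fun n =>
    exists_isClosed_projectiveFamilyContent_sdiff_lt hP (hA n) (hδ n).ne'
  have hempty : ⋂ n, K n = ∅ :=
    subset_empty_iff.1 ((iInter_mono hKA).trans hinter.subset)
  obtain ⟨T, hT⟩ := isCompact_univ.elim_finite_subfamily_closed K hKc (by rw [hempty, inter_empty])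
  filter_upwards [eventually_ge_atTop (T.sup id)] with n hn
  have hsub : A n ⊆ ⋃ i ∈ T, A i \ K i := by
    intro x hx
    have : x ∉ ⋂ i ∈ T, K i := fun h => hT.subset ⟨mem_univ x, h⟩
    simp only [mem_iInter, not_forall] at this
    obtain ⟨i, hi, hxi⟩ := this
    exact mem_biUnion hi ⟨hanti ((Finset.le_sup (f := id) hi).trans hn) hx, hxi⟩
  have hmem : ∀ i ∈ T, A i \ K i ∈ measurableCylinders fun _ : ι => E :=
    fun i _ => sdiff_mem_measurableCylinders (hA i) (hKmem i)
  calc projectiveFamilyContent hP (A n)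
      ≤ projectiveFamilyContent hP (⋃ i ∈ T, A i \ K i) :=
        addContent_mono isSetSemiring_measurableCylinders (hA n)
          (isSetRing_measurableCylinders.biUnion_mem T hmem) hsub
    _ ≤ ∑ i ∈ T, projectiveFamilyContent hP (A i \ K i) :=
        addContent_biUnion_le isSetRing_measurableCylinders hmem
    _ ≤ ∑ i ∈ T, δ i := Finset.sum_le_sum fun i _ => (hK i).le
    _ ≤ ∑' i, δ i := ENNReal.sum_le_tsum T
    _ ≤ ε := hsum.le

/-- **Kolmogorov extension theorem** for a compact metrizable state space. -/
theorem exists_isProjectiveLimit (hP : IsProjectiveMeasureFamily (α := fun _ : ι => E) P) :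
    ∃ μ : Measure (ι → E), IsProjectiveLimit μ P := by
  have hsub : (projectiveFamilyContent hP).IsSigmaSubadditive :=
    isSigmaSubadditive_of_addContent_iUnion_eq_tsum isSetRing_measurableCylinders
      fun f hf hfU hfd => addContent_iUnion_eq_sum_of_tendsto_zero isSetRing_measurableCylinders _
        (fun _ _ => projectiveFamilyContent_ne_top hP)
        (fun _ => projectiveFamilyContent_tendsto_zero hP) hf hfU hfd
  refine ⟨(projectiveFamilyContent hP).measure isSetSemiring_measurableCylinders
    generateFrom_measurableCylinders.ge hsub, fun I => ?_⟩
  ext s hs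
  rw [Measure.map_apply (by fun_prop) hs, AddContent.measure_eq, ← cylinder,
    projectiveFamilyContent_cylinder hP hs]
  · exact generateFrom_measurableCylinders.symm
  · exact cylinder_mem_measurableCylinders _ _ hs

end KolmogorovExtension

/-- A semigroup of Markov kernels indexed by `[0, ∞)`. -/
structure MarkovSemigroup (E : Type*) [MeasurableSpace E] where
  /-- the transition kernels -/
  kernel : ℝ≥0 → Kernel E E
  isMarkovKernel : ∀ t, IsMarkovKernel (kernel t)
  kernel_zero : kernel 0 = Kernel.id
  lintegral_add : ∀ s t x, ∀ g : E → ℝ≥0∞, Measurable g →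
    ∫⁻ z, g z ∂(kernel (s + t) x) = ∫⁻ w, ∫⁻ z, g z ∂(kernel t w) ∂(kernel s x)

namespace MarkovSemigroup

section

variable {E : Type*}

lemma dependsOn_eval_comp (t : ℝ≥0) (h : E → ℝ≥0∞) {A : Set ℝ≥0} (ht : t ∈ A) :
    DependsOn (fun ω : ℝ≥0 → E => h (ω t)) A :=
  fun _ _ H => congrArg h (H t ht)

lemma dependsOn_update {t : ℝ≥0} {l : List ℝ≥0} {z : E} {g : (ℝ≥0 → E) → ℝ≥0∞}
    (hg : DependsOn g {u | u ∈ t :: l}) :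
    DependsOn (fun ω => g (Function.update ω t z)) {u | u ∈ l} := by
  intro ω ω' h
  refine hg fun u hu => ?_
  by_cases hut : u = t
  · subst hut; simp
  · simpa [hut] using h u (by simpa [hut] using hu)

lemma update_of_notMem {t : ℝ≥0} {l : List ℝ≥0} (ht : t ∉ l) (z : E)
    {g : (ℝ≥0 → E) → ℝ≥0∞} (hg : DependsOn g {u | u ∈ l}) (ω : ℝ≥0 → E) :
    g (Function.update ω t z) = g ω := by
  refine hg fun u hu => ?_
  rw [Function.update_of_ne]
  rintro rfl
  exact ht hu

end

variable {E : Type*} [MeasurableSpace E] (q : MarkovSemigroup E)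

instance (t : ℝ≥0) : IsMarkovKernel (q.kernel t) := q.isMarkovKernel t

lemma lintegral_kernel_zero (x : E) {h : E → ℝ≥0∞} (hh : Measurable h) :
    ∫⁻ z, h z ∂(q.kernel 0 x) = h x := by
  rw [q.kernel_zero, Kernel.lintegral_id' hh]

/-- The law of a path whose values at the successive times of a list form a Markov chain with
transition kernels `q`, started at time `s`; the values at all other times are irrelevant. -/
noncomputable def chain : ℝ≥0 → List ℝ≥0 → Kernel E (ℝ≥0 → E)
  | _, [] => Kernel.deterministic (fun x _ => x) (by fun_prop)
  | s, t :: l => ((q.kernel (t - s)) ⊗ₖ (Kernel.prodMkLeft E (chain t l))).map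
      fun p => Function.update p.2 t p.1

lemma measurable_update_path (t : ℝ≥0) :
    Measurable fun p : E × (ℝ≥0 → E) => Function.update p.2 t p.1 := by
  refine measurable_pi_iff.2 fun u => ?_
  by_cases h : u = t
  · subst h; simpa using measurable_fst
  · simpa [h] using by fun_prop

instance (s : ℝ≥0) (l : List ℝ≥0) : IsMarkovKernel (q.chain s l) := by
  induction l generalizing s with
  | nil => rw [chain]; infer_instance
  | cons t l ih =>
    rw [chain]
    exact Kernel.IsMarkovKernel.map _ (measurable_update_path t)

lemma lintegral_chain_nil (s : ℝ≥0) (x : E) {g : (ℝ≥0 → E) → ℝ≥0∞} (hg : Measurable g) :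
    ∫⁻ ω, g ω ∂(q.chain s [] x) = g fun _ => x := by
  rw [chain, Kernel.lintegral_deterministic' _ hg]

lemma lintegral_chain_cons (s t : ℝ≥0) (l : List ℝ≥0) (x : E) {g : (ℝ≥0 → E) → ℝ≥0∞}
    (hg : Measurable g) :
    ∫⁻ ω, g ω ∂(q.chain s (t :: l) x)
      = ∫⁻ z, ∫⁻ ω, g (Function.update ω t z) ∂(q.chain t l z) ∂(q.kernel (t - s) x) := by
  rw [chain, Kernel.lintegral_map _ (measurable_update_path t) _ hg]
  exact (Kernel.lintegral_compProd _ _ _ (hg.comp (measurable_update_path t))).trans (by simp)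

lemma measurable_comp_update (t : ℝ≥0) (z : E) {g : (ℝ≥0 → E) → ℝ≥0∞} (hg : Measurable g) :
    Measurable fun ω => g (Function.update ω t z) :=
  hg.comp ((measurable_update_path t).comp (by fun_prop : Measurable fun ω => (z, ω)))

lemma measurable_lintegral_chain_update (t : ℝ≥0) (l : List ℝ≥0) {g : (ℝ≥0 → E) → ℝ≥0∞}
    (hg : Measurable g) :
    Measurable fun z => ∫⁻ ω, g (Function.update ω t z) ∂(q.chain t l z) :=
  Measurable.lintegral_kernel_prod_right' (κ := q.chain t l)
    (f := fun p => g (Function.update p.2 t p.1)) (hg.comp (measurable_update_path t))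

/-- Starting the chain at an earlier time amounts to a preliminary step of the semigroup. -/
lemma lintegral_chain_bind {s t : ℝ≥0} (hst : s ≤ t) {l : List ℝ≥0} (hl : ∀ u ∈ l, t ≤ u) (x : E)
    {g : (ℝ≥0 → E) → ℝ≥0∞} (hg : Measurable g) (hgl : DependsOn g {u | u ∈ l}) :
    ∫⁻ z, ∫⁻ ω, g ω ∂(q.chain t l z) ∂(q.kernel (t - s) x) = ∫⁻ ω, g ω ∂(q.chain s l x) := by
  cases l with
  | nil =>
    have : ∀ ω, g ω = g fun _ => x := fun ω => hgl (by simp)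
    simp [this]
  | cons t' l =>
    simp_rw [lintegral_chain_cons q _ _ _ _ hg]
    have : t' - s = (t - s) + (t' - t) := by
      have := hl t' (by simp)
      rw [add_comm, tsub_add_tsub_cancel this hst]
    rw [this, q.lintegral_add _ _ _ _ (q.measurable_lintegral_chain_update t' l hg)]

/-- Finite-dimensional consistency of the chains. -/
lemma lintegral_chain_of_sublist {l' l : List ℝ≥0} (h : l'.Sublist l) {s : ℝ≥0}
    (hl : l.Pairwise (· < ·)) (hs : ∀ u ∈ l, s ≤ u) (x : E) {g : (ℝ≥0 → E) → ℝ≥0∞}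
    (hg : Measurable g) (hgl : DependsOn g {u | u ∈ l'}) :
    ∫⁻ ω, g ω ∂(q.chain s l x) = ∫⁻ ω, g ω ∂(q.chain s l' x) := by
  induction h generalizing s x g with
  | slnil => rfl
  | @cons l' l t h ih =>
    rw [List.pairwise_cons] at hl
    have ht : t ∉ l' := fun hmem => lt_irrefl _ (hl.1 t (h.subset hmem))
    rw [lintegral_chain_cons q _ _ _ _ hg]
    simp_rw [update_of_notMem ht _ hgl]
    rw [← q.lintegral_chain_bind (hs t (by simp)) (fun u hu => (hl.1 u (h.subset hu)).le) x hg hgl]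
    congr with z
    exact ih hl.2 (fun u hu => (hl.1 u hu).le) z hg hgl
  | @cons_cons l' l t h ih =>
    rw [List.pairwise_cons] at hl
    simp_rw [lintegral_chain_cons q _ _ _ _ hg]
    congr with z
    exact ih hl.2 (fun u hu => (hl.1 u hu).le) z (measurable_comp_update t z hg)
      (dependsOn_update hgl)

/-- The Markov property at the last but one time of the chain. -/
lemma lintegral_chain_append {l : List ℝ≥0} {r s t : ℝ≥0} (hst : s < t)
    (hl : (l ++ [s]).Pairwise (· < ·)) (x : E) {g : (ℝ≥0 → E) → ℝ≥0∞} (hg : Measurable g)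
    (hgl : DependsOn g {u | u ∈ l ++ [s]}) {h : E → ℝ≥0∞} (hh : Measurable h) :
    ∫⁻ ω, g ω * h (ω t) ∂(q.chain r (l ++ [s, t]) x)
      = ∫⁻ ω, g ω * ∫⁻ z, h z ∂(q.kernel (t - s) (ω s)) ∂(q.chain r (l ++ [s]) x) := by
  have hm : ∀ g : (ℝ≥0 → E) → ℝ≥0∞, Measurable g → Measurable fun ω => g ω * h (ω t) :=
    fun g hg => hg.mul (hh.comp (measurable_pi_apply t))
  have hm' : ∀ g : (ℝ≥0 → E) → ℝ≥0∞, Measurable g →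
      Measurable fun ω => g ω * ∫⁻ z, h z ∂(q.kernel (t - s) (ω s)) :=
    fun g hg => hg.mul ((hh.lintegral_kernel (κ := q.kernel (t - s))).comp (measurable_pi_apply s))
  induction l generalizing r x g with
  | nil =>
    simp only [List.nil_append] at hgl ⊢
    rw [lintegral_chain_cons q _ _ _ _ (hm g hg), lintegral_chain_cons q _ _ _ _ (hm' g hg)]
    congr with z
    rw [lintegral_chain_cons q _ _ _ _ (measurable_comp_update s z (hm g hg)),
      lintegral_chain_nil q _ _ (measurable_comp_update s z (hm' g hg))]
    have hg' : ∀ ω : ℝ≥0 → E, g (Function.update ω s z) = g fun _ => z := fun ω => hgl (by simp)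
    simp only [hg', Function.update_self, Function.update_of_ne hst.ne']
    rw [← lintegral_const_mul _ hh]
    congr with w
    rw [lintegral_chain_nil]
    · simp
  | cons u l ih =>
    simp only [List.cons_append, List.pairwise_cons] at hl hgl ⊢
    rw [lintegral_chain_cons q _ _ _ _ (hm g hg), lintegral_chain_cons q _ _ _ _ (hm' g hg)]
    have hus : u < s := hl.1 s (by simp)
    simp only [Function.update_of_ne hus.ne', Function.update_of_ne (hus.trans hst).ne']
    congr with z
    exact ih hl.2 z (measurable_comp_update u z hg) (dependsOn_update hgl)


/-- The finite-dimensional laws of the Markov process with semigroup `q` started at `x`. -/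
noncomputable def finiteLaw (x : E) (J : Finset ℝ≥0) : Measure (J → E) :=
  (q.chain 0 (J.sort (· ≤ ·)) x).map J.restrict

instance (x : E) (J : Finset ℝ≥0) : IsProbabilityMeasure (q.finiteLaw x J) :=
  Measure.isProbabilityMeasure_map (Finset.measurable_restrict J).aemeasurable

lemma isProjectiveMeasureFamily_finiteLaw (x : E) :
    IsProjectiveMeasureFamily (α := fun _ : ℝ≥0 => E) (q.finiteLaw x) := by
  intro I J hJI
  ext S hS
  have hmeas : Measurable (cylinder J S |>.indicator (1 : (ℝ≥0 → E) → ℝ≥0∞)) :=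
    measurable_one.indicator (hS.cylinder J)
  have hsub : (J.sort (· ≤ ·)).Sublist (I.sort (· ≤ ·)) :=
    List.sublist_of_subperm_of_pairwise
      (List.subperm_of_subset (Finset.sort_nodup _ _) fun u hu => by
        simpa using hJI (by simpa using hu))
      (Finset.pairwise_sort _ _) (Finset.pairwise_sort _ _)
  have hdep : DependsOn ((cylinder J S).indicator (1 : (ℝ≥0 → E) → ℝ≥0∞))
      {u | u ∈ J.sort (· ≤ ·)} := by
    intro ω ω' H
    exact dependsOn_cylinder_indicator_const (α := fun _ : ℝ≥0 => E) S (1 : ℝ≥0∞)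
      fun u hu => H u (by simpa using hu)
  have key := q.lintegral_chain_of_sublist hsub (s := 0) (Finset.sortedLT_sort I).pairwise
    (fun _ _ => zero_le) x hmeas hdep
  have hr : Measurable (Finset.restrict₂ (π := fun _ : ℝ≥0 => E) hJI) :=
    Finset.measurable_restrict₂ hJI
  rw [finiteLaw, finiteLaw, Measure.map_map hr (by fun_prop), Finset.restrict₂_comp_restrict,
    Measure.map_apply (by fun_prop) hS, Measure.map_apply (by fun_prop) hS]
  rw [lintegral_indicator_one (hS.cylinder J), lintegral_indicator_one (hS.cylinder J)] at key
  exact key.symm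

section PathLaw

variable [TopologicalSpace E] [CompactSpace E] [TopologicalSpace.PseudoMetrizableSpace E]
  [SecondCountableTopology E] [BorelSpace E]

/-- The law on path space of the Markov process with semigroup `q` started at `x`. -/
noncomputable def pathLaw (x : E) : Measure (ℝ≥0 → E) :=
  (exists_isProjectiveLimit (q.isProjectiveMeasureFamily_finiteLaw x)).choose

lemma isProjectiveLimit_pathLaw (x : E) :
    IsProjectiveLimit (α := fun _ : ℝ≥0 => E) (q.pathLaw x) (q.finiteLaw x) :=
  (exists_isProjectiveLimit (q.isProjectiveMeasureFamily_finiteLaw x)).choose_spec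

instance (x : E) : IsProbabilityMeasure (q.pathLaw x) :=
  (q.isProjectiveLimit_pathLaw x).isProbabilityMeasure

lemma lintegral_pathLaw {l : List ℝ≥0} (hl : l.Pairwise (· < ·)) (x : E)
    {g : (ℝ≥0 → E) → ℝ≥0∞} (hg : Measurable g) (hgl : DependsOn g {u | u ∈ l}) :
    ∫⁻ ω, g ω ∂(q.pathLaw x) = ∫⁻ ω, g ω ∂(q.chain 0 l x) := by
  classical
  let e : (l.toFinset → E) → ℝ≥0 → E := fun y u => if h : u ∈ l.toFinset then y ⟨u, h⟩ else x
  have he : Measurable e := by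
    refine measurable_pi_iff.2 fun u => ?_
    by_cases h : u ∈ l.toFinset
    · simpa only [e, h, dif_pos] using measurable_pi_apply _
    · simp only [e, h, dif_neg, not_false_eq_true, measurable_const]
  have hge : ∀ ω, g ω = g (e (l.toFinset.restrict ω)) := fun ω => hgl fun u hu => by
    have : u ∈ l.toFinset := by simpa using hu
    simp only [e, Finset.restrict, dif_pos this]
  have hsort : l.toFinset.sort (· ≤ ·) = l :=
    (List.toFinset_sort (· ≤ ·) (hl.imp ne_of_lt)).2 (hl.imp le_of_lt)
  have hm := hg.comp he
  calc ∫⁻ ω, g ω ∂(q.pathLaw x)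
      = ∫⁻ ω, g (e (l.toFinset.restrict ω)) ∂(q.pathLaw x) := lintegral_congr hge
    _ = ∫⁻ y, g (e y) ∂((q.pathLaw x).map l.toFinset.restrict) :=
        (lintegral_map hm (Finset.measurable_restrict _)).symm
    _ = ∫⁻ y, g (e y) ∂(q.finiteLaw x l.toFinset) := by rw [q.isProjectiveLimit_pathLaw x]
    _ = ∫⁻ ω, g (e (l.toFinset.restrict ω)) ∂(q.chain 0 l x) := by
        rw [finiteLaw, hsort]; exact lintegral_map hm (Finset.measurable_restrict _)
    _ = ∫⁻ ω, g ω ∂(q.chain 0 l x) := (lintegral_congr hge).symm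

/-- The one-dimensional laws of the process are given by the semigroup. -/
lemma lintegral_pathLaw_eval (t : ℝ≥0) (x : E) {h : E → ℝ≥0∞} (hh : Measurable h) :
    ∫⁻ ω, h (ω t) ∂(q.pathLaw x) = ∫⁻ z, h z ∂(q.kernel t x) := by
  have hm : Measurable fun ω : ℝ≥0 → E => h (ω t) := hh.comp (measurable_pi_apply t)
  rw [q.lintegral_pathLaw (l := [t]) (by simp) x hm (dependsOn_eval_comp t h (by simp)),
    lintegral_chain_cons q _ _ _ _ hm]
  simp

/-- The Markov property of the process, tested on functions of finitely many coordinates. -/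
lemma lintegral_pathLaw_markov {s t : ℝ≥0} (hst : s ≤ t) (x : E) {J : Finset ℝ≥0}
    (hJ : ∀ u ∈ J, u ≤ s) {g : (ℝ≥0 → E) → ℝ≥0∞} (hg : Measurable g) (hgJ : DependsOn g J)
    {h : E → ℝ≥0∞} (hh : Measurable h) :
    ∫⁻ ω, g ω * h (ω t) ∂(q.pathLaw x)
      = ∫⁻ ω, g ω * ∫⁻ z, h z ∂(q.kernel (t - s) (ω s)) ∂(q.pathLaw x) := by
  rcases hst.eq_or_lt with rfl | hst
  · simp_rw [tsub_self, q.lintegral_kernel_zero _ hh]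
  set l := (J.erase s).sort (· ≤ ·) with hl
  have hmem : ∀ u ∈ l, u < s := fun u hu => by
    have : u ≠ s ∧ u ∈ J := by simpa [hl] using hu
    exact (hJ u this.2).lt_of_ne this.1
  have hls : (l ++ [s]).Pairwise (· < ·) :=
    List.pairwise_append.2 ⟨(Finset.sortedLT_sort _).pairwise, by simp, by simpa using hmem⟩
  have hlst : (l ++ [s, t]).Pairwise (· < ·) :=
    List.pairwise_append.2 ⟨(Finset.sortedLT_sort _).pairwise, by simpa using hst,
      by simpa using fun u hu => ⟨hmem u hu, (hmem u hu).trans hst⟩⟩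
  have hJl : (J : Set ℝ≥0) ⊆ {u | u ∈ l ++ [s]} := fun u hu => by
    by_cases h : u = s <;> simp_all
  have hgl : DependsOn g {u | u ∈ l ++ [s]} := fun ω ω' H => hgJ fun u hu => H u (hJl hu)
  have hm : Measurable fun ω => g ω * h (ω t) := hg.mul (hh.comp (measurable_pi_apply t))
  have hm' : Measurable fun ω => g ω * ∫⁻ z, h z ∂(q.kernel (t - s) (ω s)) :=
    hg.mul ((hh.lintegral_kernel (κ := q.kernel (t - s))).comp (measurable_pi_apply s))
  rw [q.lintegral_pathLaw hlst x hm, q.lintegral_pathLaw hls x hm',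
    q.lintegral_chain_append hst hls x hg hgl hh]
  · intro ω ω' H
    simp only
    rw [hgl H, H s (by simp)]
  · intro ω ω' H
    simp only
    rw [hgl fun u hu => H u (by have : u ∈ l ∨ u = s := by simpa using hu
                                rcases this with h | h <;> simp [h]), H t (by simp)]

end PathLaw

end MarkovSemigroup

lemma measurable_down_eval {E : Type*} [MeasurableSpace E] (t : ℝ≥0) :
    Measurable fun ω : ULift.{v} (ℝ≥0 → E) => ω.down t :=
  (measurable_pi_apply t).comp measurable_down

section PathProcess

variable {E : Type*} [MeasurableSpace E] [TopologicalSpace E] [CompactSpace E]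
  [TopologicalSpace.PseudoMetrizableSpace E] [SecondCountableTopology E] [BorelSpace E]

namespace MarkovSemigroup

variable (q : MarkovSemigroup E)

/-- The law of the process with semigroup `q` started at `x`, on a lifted copy of path space. -/
noncomputable def liftedLaw (x : E) : Measure (ULift.{v} (ℝ≥0 → E)) :=
  (q.pathLaw x).map ULift.up

instance (x : E) : IsProbabilityMeasure (q.liftedLaw x) :=
  Measure.isProbabilityMeasure_map measurable_up.aemeasurable

lemma liftedLaw_preimage (t : ℝ≥0) (x : E) {A : Set E} (hA : MeasurableSet A) :
    q.liftedLaw x ((fun ω : ULift.{v} (ℝ≥0 → E) => ω.down t) ⁻¹' A) = q.kernel t x A := by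
  rw [liftedLaw, Measure.map_apply measurable_up (measurable_down_eval t hA)]
  have h := q.lintegral_pathLaw_eval t x (measurable_one.indicator hA)
  rw [lintegral_indicator_one hA] at h
  rw [← h]
  exact (lintegral_indicator_one ((measurable_pi_apply t) hA)).symm

lemma liftedLaw_inter_preimage {s t : ℝ≥0} (hst : s ≤ t) (x : E) {A : Set E}
    (hA : MeasurableSet A) {B : Set (ULift.{v} (ℝ≥0 → E))}
    (hB : MeasurableSet[⨆ u ∈ Iic s, MeasurableSpace.comap (fun ω => ω.down u) inferInstance] B) :
    ∫⁻ ω in B, q.kernel (t - s) (ω.down s) A ∂(q.liftedLaw x)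
      = q.liftedLaw x (B ∩ (fun ω => ω.down t) ⁻¹' A) := by
  have hAt := measurable_down_eval.{v} (E := E) t hA
  have hle : (⨆ u ∈ Iic s, MeasurableSpace.comap
      (fun ω : ULift.{v} (ℝ≥0 → E) => ω.down u) inferInstance)
      ≤ (inferInstance : MeasurableSpace (ULift.{v} (ℝ≥0 → E))) :=
    iSup₂_le fun u _ => (measurable_down_eval u).comap_le
  have hk : Measurable fun ω : ULift.{v} (ℝ≥0 → E) => q.kernel (t - s) (ω.down s) A :=
    ((q.kernel (t - s)).measurable_coe hA).comp (measurable_down_eval s)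
  have hfin : ∀ C : Set (ULift.{v} (ℝ≥0 → E)),
      ∫⁻ ω in C, q.kernel (t - s) (ω.down s) A ∂(q.liftedLaw x) ≠ ∞ := fun C =>
    ne_top_of_le_ne_top (measure_ne_top (q.liftedLaw x) C)
      ((lintegral_mono fun _ => prob_le_one).trans_eq (by simp))
  have hbase : ∀ J : Finset ℝ≥0, (∀ u ∈ J, u ≤ s) → ∀ C : ℝ≥0 → Set E,
      (∀ u ∈ J, MeasurableSet (C u)) → ∀ B' : Set (ULift.{v} (ℝ≥0 → E)),
      B' = ⋂ u ∈ J, (fun ω : ULift.{v} (ℝ≥0 → E) => ω.down u) ⁻¹' C u →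
      ∫⁻ ω in B', q.kernel (t - s) (ω.down s) A ∂(q.liftedLaw x)
        = q.liftedLaw x (B' ∩ (fun ω => ω.down t) ⁻¹' A) := by
    rintro J hJ C hC B' rfl
    set D : Set (ℝ≥0 → E) := ⋂ u ∈ J, (fun ω => ω u) ⁻¹' C u with hD
    have hDm : MeasurableSet D :=
      Finset.measurableSet_biInter J fun u hu => measurable_pi_apply u (hC u hu)
    have hBm : MeasurableSet
        (⋂ u ∈ J, (fun ω : ULift.{v} (ℝ≥0 → E) => ω.down u) ⁻¹' C u) :=
      Finset.measurableSet_biInter J fun u hu => measurable_down_eval u (hC u hu)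
    have hdep : DependsOn (D.indicator (1 : (ℝ≥0 → E) → ℝ≥0∞)) J := by
      intro ω ω' H
      have : ω ∈ D ↔ ω' ∈ D := by
        simp only [hD, mem_iInter, mem_preimage]
        exact forall₂_congr fun u hu => by rw [H u hu]
      by_cases h : ω ∈ D
      · rw [indicator_of_mem h, indicator_of_mem (this.1 h)]; rfl
      · rw [indicator_of_notMem h, indicator_of_notMem (fun h' => h (this.2 h'))]
    have key := q.lintegral_pathLaw_markov hst x hJ (measurable_one.indicator hDm) hdep
      (measurable_one.indicator hA)
    simp only [lintegral_indicator_one hA] at key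
    rw [← lintegral_indicator hBm, liftedLaw, lintegral_map (hk.indicator hBm) measurable_up,
      Measure.map_apply measurable_up (hBm.inter hAt),
      ← lintegral_indicator_one (measurable_up (hBm.inter hAt))]
    convert key.symm using 1
    · refine lintegral_congr fun ω => ?_
      by_cases h : ω ∈ D
      · rw [indicator_of_mem h, indicator_of_mem (by simpa [hD] using h)]; simp
      · rw [indicator_of_notMem h, indicator_of_notMem (by simpa [hD] using h)]; simp
    · have hset : ULift.up.{v} ⁻¹' ((⋂ u ∈ J, (fun ω : ULift.{v} (ℝ≥0 → E) => ω.down u) ⁻¹' C u) ∩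
          (fun ω => ω.down t) ⁻¹' A) = D ∩ (fun ω => ω t) ⁻¹' A := by
        ext ω; simp [hD]
      rw [hset]
      refine lintegral_congr fun ω => ?_
      by_cases h : ω ∈ D <;> by_cases h' : ω t ∈ A <;> simp [h, h']
  refine MeasurableSpace.induction_on_inter
    (C := fun B _ => ∫⁻ ω in B, q.kernel (t - s) (ω.down s) A ∂(q.liftedLaw x)
      = q.liftedLaw x (B ∩ (fun ω => ω.down t) ⁻¹' A))
    (generateFrom_piiUnionInter_measurableSet _ _).symm
    (isPiSystem_piiUnionInter _ (fun u => @MeasurableSpace.isPiSystem_measurableSet _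
      (MeasurableSpace.comap (fun ω : ULift.{v} (ℝ≥0 → E) => ω.down u) inferInstance)) _)
    ?_ ?_ ?_ ?_ B hB
  · simp
  · rintro B' ⟨J, hJ, f, hf, rfl⟩
    choose! C hC using hf
    exact hbase J (fun u hu => hJ hu) C (fun u hu => (hC u hu).1) _
      (iInter₂_congr fun u hu => (hC u hu).2.symm)
  · intro B' hB' ih
    have hB'm := hle _ hB'
    have huniv := hbase ∅ (by simp) (fun _ => univ) (by simp) univ (by simp)
    rw [Measure.restrict_univ, univ_inter] at huniv
    have h1 := lintegral_add_compl (μ := q.liftedLaw x)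
      (fun ω : ULift.{v} (ℝ≥0 → E) => q.kernel (t - s) (ω.down s) A) hB'm
    have h2 := measure_inter_add_sdiff (μ := q.liftedLaw x)
      ((fun ω : ULift.{v} (ℝ≥0 → E) => ω.down t) ⁻¹' A) hB'm
    rw [huniv, ← h2, ih, inter_comm B'] at h1
    rw [(ENNReal.add_right_inj (measure_ne_top _ _)).1 h1, sdiff_eq, inter_comm]
  · intro f hd hf ih
    rw [lintegral_iUnion (fun i => hle _ (hf i)) hd, iUnion_inter,
      measure_iUnion (fun i j hij => (hd hij).mono inter_subset_left inter_subset_left)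
        (fun i => (hle _ (hf i)).inter hAt)]
    exact tsum_congr ih

end MarkovSemigroup

end PathProcess

/-- A semigroup of Markov kernels on `[0, ∞]` is the transition semigroup of a positive Markov
process. -/
noncomputable def MarkovSemigroup.process (q : MarkovSemigroup ℝ≥0∞) :
    PositiveMarkovProcess.{v} where
  Ω := ULift.{v} (ℝ≥0 → ℝ≥0∞)
  mΩ := inferInstance
  X t ω := ω.down t
  P := q.liftedLaw
  isProb _ := inferInstance
  measurable_X := measurable_down_eval
  measurable_P t A hA := by
    simp_rw [q.liftedLaw_preimage t _ hA]
    exact (q.kernel t).measurable_coe hA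
  normal x := by
    have := q.liftedLaw_preimage.{v} 0 x (measurableSet_singleton x)
    rw [q.kernel_zero, Kernel.id_apply] at this
    exact this.trans (by simp)
  markov s t hst A hA x := by
    have hAt := measurable_down_eval.{v} (E := ℝ≥0∞) t hA
    have hle : (⨆ u ∈ Iic s, MeasurableSpace.comap
        (fun ω : ULift.{v} (ℝ≥0 → ℝ≥0∞) => ω.down u) inferInstance)
        ≤ (inferInstance : MeasurableSpace (ULift.{v} (ℝ≥0 → ℝ≥0∞))) :=
      iSup₂_le fun u _ => (measurable_down_eval u).comap_le
    have hreal : ∀ y, (q.liftedLaw.{v} y).real ((fun ω => ω.down (t - s)) ⁻¹' A)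
        = (q.kernel (t - s) y A).toReal := fun y => by
      rw [measureReal_def, q.liftedLaw_preimage _ _ hA]
    simp only [hreal]
    have hk := (q.kernel (t - s)).measurable_coe hA
    have hks : Measurable fun ω : ULift.{v} (ℝ≥0 → ℝ≥0∞) => q.kernel (t - s) (ω.down s) A :=
      hk.comp (measurable_down_eval s)
    have hmeas : Measurable fun ω : ULift.{v} (ℝ≥0 → ℝ≥0∞) =>
        (q.kernel (t - s) (ω.down s) A).toReal :=
      hks.ennreal_toReal
    have hint : Integrable (fun ω : ULift.{v} (ℝ≥0 → ℝ≥0∞) =>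
        (q.kernel (t - s) (ω.down s) A).toReal) (q.liftedLaw x) :=
      .of_bound hmeas.aestronglyMeasurable 1 (.of_forall fun ω => by
        simpa using ENNReal.toReal_mono ENNReal.one_ne_top prob_le_one)
    refine (ae_eq_condExp_of_forall_setIntegral_eq hle
      ((integrable_const _).indicator hAt) (fun B _ _ => hint.integrableOn) ?_ ?_).symm
    · intro B hB _
      rw [integral_toReal hks.aemeasurable
        (.of_forall fun ω => measure_lt_top _ _), q.liftedLaw_inter_preimage hst x hA hB,
        setIntegral_indicator hAt]
      simp [measureReal_def]
    · refine (Measurable.stronglyMeasurable ?_).aestronglyMeasurable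
      refine (hk.ennreal_toReal).comp ?_
      exact (comap_measurable _).mono (le_iSup₂_of_le s (mem_Iic.2 le_rfl) le_rfl) le_rfl

lemma MarkovSemigroup.process_trans (q : MarkovSemigroup ℝ≥0∞) (t : ℝ≥0) (x : ℝ≥0∞) :
    q.process.trans t x = q.kernel t x := by
  ext A hA
  rw [PositiveMarkovProcess.trans, Measure.map_apply (q.process.measurable_X t) hA]
  exact q.liftedLaw_preimage t x hA

section ExpKernel

@[simp] lemma expNeg_top : expNeg ∞ = 0 := if_pos rfl

lemma expNeg_of_ne_top {z : ℝ≥0∞} (hz : z ≠ ∞) : expNeg z = Real.exp (-z.toReal) := if_neg hz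

@[simp] lemma expNeg_zero : expNeg 0 = 1 := by simp [expNeg]

lemma expNeg_ofReal {r : ℝ} (hr : 0 ≤ r) : expNeg (ENNReal.ofReal r) = Real.exp (-r) := by
  rw [expNeg_of_ne_top ENNReal.ofReal_ne_top, ENNReal.toReal_ofReal hr]

lemma expNeg_nonneg (z : ℝ≥0∞) : 0 ≤ expNeg z := by
  unfold expNeg; split_ifs <;> positivity

lemma expNeg_strictAnti : StrictAnti expNeg := by
  intro a b hab
  rw [expNeg_of_ne_top hab.ne_top]
  rcases eq_or_ne b ∞ with rfl | hb
  · simpa using Real.exp_pos _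
  · rw [expNeg_of_ne_top hb]
    simpa using ENNReal.toReal_strict_mono hb hab

lemma expNeg_le_one (z : ℝ≥0∞) : expNeg z ≤ 1 := by
  simpa using expNeg_strictAnti.antitone (zero_le (a := z))

lemma expNeg_add (a b : ℝ≥0∞) : expNeg (a + b) = expNeg a * expNeg b := by
  rcases eq_or_ne a ∞ with rfl | ha
  · simp
  rcases eq_or_ne b ∞ with rfl | hb
  · simp
  rw [expNeg_of_ne_top ha, expNeg_of_ne_top hb, expNeg_of_ne_top (by finiteness),
    ENNReal.toReal_add ha hb, neg_add, Real.exp_add]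

lemma expNeg_natCast_mul (n : ℕ) (a : ℝ≥0∞) : expNeg (n * a) = expNeg a ^ n := by
  induction n with
  | zero => simp
  | succ n ih => rw [Nat.cast_succ, add_mul, one_mul, expNeg_add, ih, pow_succ]

lemma exists_expNeg_eq {t : ℝ} (h0 : 0 ≤ t) (h1 : t ≤ 1) : ∃ z, expNeg z = t := by
  rcases h0.eq_or_lt with rfl | h0
  · exact ⟨∞, by simp⟩
  · refine ⟨ENNReal.ofReal (-Real.log t), ?_⟩
    rw [expNeg_ofReal (by simpa using Real.log_nonpos h0.le h1), neg_neg, Real.exp_log h0]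

lemma continuous_expNeg : Continuous expNeg := by
  refine continuous_iff_continuousAt.2 fun z => ?_
  rcases eq_or_ne z ∞ with rfl | hz
  · rw [ContinuousAt, expNeg_top]
    refine tendsto_order.2 ⟨fun a ha => .of_forall fun w => ha.trans_le (expNeg_nonneg w),
      fun a ha => ?_⟩
    have : ∃ w : ℝ≥0∞, w ≠ ∞ ∧ expNeg w < a := by
      obtain ⟨n, hn⟩ := exists_nat_gt (-Real.log a)
      refine ⟨n, by simp, ?_⟩
      rw [expNeg_of_ne_top (by simp), ← Real.lt_log_iff_exp_lt ha]
      simp; linarith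
    obtain ⟨w, hw, hwa⟩ := this
    filter_upwards [Ioi_mem_nhds hw.lt_top] with v hv
    exact (expNeg_strictAnti hv).trans hwa
  · have : expNeg =ᶠ[𝓝 z] fun w => Real.exp (-w.toReal) := by
      filter_upwards [Iio_mem_nhds hz.lt_top] with w hw
      exact expNeg_of_ne_top hw.ne
    rw [continuousAt_congr this]
    exact (ENNReal.continuousAt_toReal hz).neg.rexp

lemma measurable_expNeg : Measurable expNeg := continuous_expNeg.measurable

lemma measurable_convMul (c₁ : ZeroTimesTop) (c₂ : TopTimesZero) :
    Measurable fun p : ℝ≥0∞ × ℝ≥0∞ => convMul c₁ c₂ p.1 p.2 := by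
  unfold convMul
  refine Measurable.ite ?_ measurable_const (Measurable.ite ?_ measurable_const (by fun_prop))
  · exact (measurableSet_eq_fun measurable_fst measurable_const).inter
      (measurableSet_eq_fun measurable_snd measurable_const)
  · exact (measurableSet_eq_fun measurable_fst measurable_const).inter
      (measurableSet_eq_fun measurable_snd measurable_const)

lemma measurable_expKernel (c₁ : ZeroTimesTop) (c₂ : TopTimesZero) :
    Measurable fun p : ℝ≥0∞ × ℝ≥0∞ => expKernel c₁ c₂ p.1 p.2 :=
  measurable_expNeg.comp (measurable_convMul c₁ c₂)

variable {c₁ : ZeroTimesTop} {c₂ : TopTimesZero}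

lemma measurable_expKernel_left (y : ℝ≥0∞) : Measurable fun x => expKernel c₁ c₂ x y :=
  (measurable_expKernel c₁ c₂).comp (measurable_id.prodMk measurable_const)

lemma measurable_expKernel_right (x : ℝ≥0∞) : Measurable fun y => expKernel c₁ c₂ x y :=
  (measurable_expKernel c₁ c₂).comp (measurable_const.prodMk measurable_id)

lemma expKernel_nonneg (x y : ℝ≥0∞) : 0 ≤ expKernel c₁ c₂ x y := expNeg_nonneg _

lemma expKernel_le_one (x y : ℝ≥0∞) : expKernel c₁ c₂ x y ≤ 1 := expNeg_le_one _

lemma norm_expKernel_le (x y : ℝ≥0∞) : ‖expKernel c₁ c₂ x y‖ ≤ 1 := by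
  rw [Real.norm_of_nonneg (expKernel_nonneg x y)]; exact expKernel_le_one x y

lemma expKernel_of_left {x : ℝ≥0∞} (h0 : x ≠ 0) (ht : x ≠ ∞) (y : ℝ≥0∞) :
    expKernel c₁ c₂ x y = expNeg (x * y) := by
  simp [expKernel, convMul, h0, ht]

lemma expKernel_of_right {y : ℝ≥0∞} (h0 : y ≠ 0) (ht : y ≠ ∞) (x : ℝ≥0∞) :
    expKernel c₁ c₂ x y = expNeg (x * y) := by
  simp [expKernel, convMul, h0, ht]

lemma expKernel_of_ne_top {x y : ℝ≥0∞} (hx : x ≠ ∞) (hy : y ≠ ∞) :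
    expKernel c₁ c₂ x y = expNeg (x * y) := by
  simp [expKernel, convMul, hx, hy]

lemma expKernel_zero_left_topMinus (y : ℝ≥0∞) : expKernel .topMinus c₂ 0 y = 1 := by
  simp [expKernel, convMul, ZeroTimesTop.val]

lemma expKernel_zero_left_zeroPlus (y : ℝ≥0∞) :
    expKernel .zeroPlus c₂ 0 y = if y = ∞ then 0 else 1 := by
  by_cases h : y = ∞ <;> simp [expKernel, convMul, ZeroTimesTop.val, h]

lemma expKernel_top_left_zeroPlus (y : ℝ≥0∞) : expKernel c₁ .zeroPlus ∞ y = 0 := by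
  by_cases h : y = 0 <;> simp [expKernel, convMul, TopTimesZero.val, h]

lemma expKernel_top_left_topMinus (y : ℝ≥0∞) :
    expKernel c₁ .topMinus ∞ y = if y = 0 then 1 else 0 := by
  by_cases h : y = 0 <;> simp [expKernel, convMul, TopTimesZero.val, h]

/-- The convention for `0 · ∞` after exchanging the two factors of `∞ · 0`. -/
def TopTimesZero.swap : TopTimesZero → ZeroTimesTop
  | .zeroPlus => .zeroPlus
  | .topMinus => .topMinus

/-- The convention for `∞ · 0` after exchanging the two factors of `0 · ∞`. -/
def ZeroTimesTop.swap : ZeroTimesTop → TopTimesZero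
  | .zeroPlus => .zeroPlus
  | .topMinus => .topMinus

lemma expKernel_swap (x y : ℝ≥0∞) : expKernel c₂.swap c₁.swap y x = expKernel c₁ c₂ x y := by
  have h1 : c₂.swap.val = c₂.val := by cases c₂ <;> rfl
  have h2 : c₁.swap.val = c₁.val := by cases c₁ <;> rfl
  unfold expKernel convMul
  rw [h1, h2, mul_comm y x]
  by_cases hx0 : x = 0 <;> by_cases hy0 : y = 0 <;> by_cases hxt : x = ∞ <;>
    by_cases hyt : y = ∞ <;> simp_all

lemma expKernel_top_right_topMinus (x : ℝ≥0∞) :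
    expKernel .topMinus c₂ x ∞ = if x = 0 then 1 else 0 := by
  rw [← expKernel_swap]; exact expKernel_top_left_topMinus x

lemma expKernel_top_right_zeroPlus (x : ℝ≥0∞) : expKernel .zeroPlus c₂ x ∞ = 0 := by
  rw [← expKernel_swap]; exact expKernel_top_left_zeroPlus x

lemma expKernel_zero_right_topMinus (x : ℝ≥0∞) : expKernel c₁ .topMinus x 0 = 1 := by
  rw [← expKernel_swap]; exact expKernel_zero_left_topMinus x

lemma expKernel_zero_right_zeroPlus (x : ℝ≥0∞) :
    expKernel c₁ .zeroPlus x 0 = if x = ∞ then 0 else 1 := by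
  rw [← expKernel_swap]; exact expKernel_zero_left_zeroPlus x

lemma integrable_expKernel_left (μ : Measure ℝ≥0∞) [IsFiniteMeasure μ] (y : ℝ≥0∞) :
    Integrable (fun x => expKernel c₁ c₂ x y) μ :=
  .of_bound (measurable_expKernel_left y).aestronglyMeasurable 1
    (.of_forall fun x => norm_expKernel_le x y)

lemma integrable_expKernel_right (μ : Measure ℝ≥0∞) [IsFiniteMeasure μ] (x : ℝ≥0∞) :
    Integrable (fun y => expKernel c₁ c₂ x y) μ :=
  .of_bound (measurable_expKernel_right x).aestronglyMeasurable 1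
    (.of_forall fun y => norm_expKernel_le x y)

lemma antitone_expKernel_left (y : ℝ≥0∞) : Antitone fun x => expKernel c₁ c₂ x y := by
  intro a b hab
  rcases eq_or_ne y 0 with rfl | h0
  · cases c₂
    · simp only [expKernel_zero_right_zeroPlus]
      by_cases ha : a = ∞
      · have : b = ∞ := top_le_iff.1 (ha ▸ hab)
        simp [ha, this]
      · simp only [ha, if_false]; split_ifs <;> norm_num
    · simp [expKernel_zero_right_topMinus]
  rcases eq_or_ne y ∞ with rfl | ht
  · cases c₁
    · simp [expKernel_top_right_zeroPlus]
    · simp only [expKernel_top_right_topMinus]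
      by_cases hb : b = 0
      · have : a = 0 := le_zero_iff.1 (hb ▸ hab)
        simp [hb, this]
      · simp only [hb, if_false]; split_ifs <;> norm_num
  simp only [expKernel_of_right h0 ht]
  exact expNeg_strictAnti.antitone (by gcongr)

end ExpKernel

section HausdorffMoments

open Polynomial in
lemma sum_choose_mul_bernstein (m p : ℕ) :
    ∑ k ∈ Finset.range (p + m + 1), (k.choose p : ℝ[X]) * bernsteinPolynomial ℝ (p + m) k
      = ((p + m).choose p : ℝ[X]) * X ^ p := by
  rw [add_assoc, Finset.sum_range_add, Finset.sum_eq_zero, zero_add]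
  · have : ∀ i ∈ Finset.range (m + 1), ((p + i).choose p : ℝ[X]) *
        bernsteinPolynomial ℝ (p + m) (p + i)
        = ((p + m).choose p : ℝ[X]) * X ^ p * bernsteinPolynomial ℝ m i := fun i hi => by
      have hi' : i ≤ m := Nat.lt_succ_iff.1 (Finset.mem_range.1 hi)
      have h := Nat.choose_mul (n := p + m) (k := p + i) (s := p) (by omega)
      rw [Nat.add_sub_cancel_left, Nat.add_sub_cancel_left] at h
      have h' : ((p + m).choose (p + i) : ℝ[X]) * ((p + i).choose p : ℝ[X])
        = ((p + m).choose p : ℝ[X]) * (m.choose i : ℝ[X]) := by exact_mod_cast h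
      simp only [bernsteinPolynomial]
      rw [show p + m - (p + i) = m - i by omega, pow_add]
      linear_combination (X ^ p * X ^ i * (1 - X) ^ (m - i)) * h'
    rw [Finset.sum_congr rfl this, ← Finset.mul_sum, bernsteinPolynomial.sum, mul_one]
  · intro k hk
    rw [Nat.choose_eq_zero_of_lt (Finset.mem_range.1 hk)]
    simp

/-- The linear functional on polynomials with moments `a`. -/
noncomputable def momentFunctional (a : ℕ → ℝ) : Polynomial ℝ →ₗ[ℝ] ℝ :=
  Polynomial.lsum fun k => LinearMap.mulRight ℝ (a k)

open Polynomial in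
lemma momentFunctional_C_mul_X_pow (a : ℕ → ℝ) (c : ℝ) (k : ℕ) :
    momentFunctional a (C c * X ^ k) = c * a k := by
  rw [momentFunctional, Polynomial.lsum_apply, Polynomial.C_mul_X_pow_eq_monomial, Polynomial.sum_monomial_index] <;> simp

/-- The Bernstein weights of a moment sequence. -/
noncomputable def bernsteinWeight (a : ℕ → ℝ) (n k : ℕ) : ℝ :=
  n.choose k * ∑ j ∈ Finset.range (n - k + 1), (-1) ^ j * (n - k).choose j * a (k + j)

open Polynomial in
lemma momentFunctional_bernstein (a : ℕ → ℝ) (n k : ℕ) :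
    momentFunctional a (bernsteinPolynomial ℝ n k) = bernsteinWeight a n k := by
  have : bernsteinPolynomial ℝ n k = ∑ j ∈ Finset.range (n - k + 1),
      C ((n.choose k : ℝ) * ((-1) ^ j * (n - k).choose j)) * X ^ (k + j) := by
    rw [bernsteinPolynomial, sub_eq_neg_add, add_pow, Finset.mul_sum]
    refine Finset.sum_congr rfl fun j _ => ?_
    rw [neg_pow (X : ℝ[X]) j]
    simp only [map_mul, map_pow, map_neg, map_one, map_natCast, one_pow]
    ring
  rw [this, map_sum, bernsteinWeight, Finset.mul_sum]
  refine Finset.sum_congr rfl fun j _ => ?_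
  rw [momentFunctional_C_mul_X_pow]
  ring

lemma sum_choose_mul_bernsteinWeight (a : ℕ → ℝ) {n p : ℕ} (hp : p ≤ n) :
    ∑ k ∈ Finset.range (n + 1), (k.choose p : ℝ) * bernsteinWeight a n k = n.choose p * a p := by
  obtain ⟨m, rfl⟩ := Nat.exists_eq_add_of_le hp
  have h := congrArg (momentFunctional a) (sum_choose_mul_bernstein m p)
  rw [map_sum] at h
  have hC : ∀ (c : ℕ) (P : Polynomial ℝ),
      momentFunctional a ((c : Polynomial ℝ) * P) = c * momentFunctional a P := fun c P => by
    rw [← nsmul_eq_mul, map_nsmul, nsmul_eq_mul]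
  simp only [hC, momentFunctional_bernstein] at h
  rw [h, ← one_mul (Polynomial.X ^ p), ← Polynomial.C_1, momentFunctional_C_mul_X_pow, one_mul]

lemma abs_choose_div_choose_sub_pow_le {n k p : ℕ} (hk : k ≤ n) (hp : p < n) :
    |(k.choose p : ℝ) / n.choose p - (k / n : ℝ) ^ p| ≤ p ^ 2 / (n - p) := by
  induction p with
  | zero => simp
  | succ p ih =>
    have hn : (0 : ℝ) < n := by exact_mod_cast (by omega : 0 < n)
    have hnp : (0 : ℝ) < (n : ℝ) - (p + 1) := by
      have : ((p + 1 : ℕ) : ℝ) < n := by exact_mod_cast hp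
      push_cast at this; linarith
    have hkn : (k : ℝ) ≤ n := by exact_mod_cast hk
    have hk0 : (0 : ℝ) ≤ k := by positivity
    have hsucc : ∀ m : ℕ, (m.choose (p + 1) : ℝ) * (p + 1) = m.choose p * ((m : ℝ) - p) := by
      intro m
      rcases le_or_gt p m with h | h
      · rw [← Nat.cast_sub h]; exact_mod_cast Nat.choose_succ_right_eq m p
      · rw [Nat.choose_eq_zero_of_lt h, Nat.choose_eq_zero_of_lt (by omega)]; simp
    have hpos : (0 : ℝ) < n.choose p := by exact_mod_cast Nat.choose_pos (by omega)
    have hpos' : (0 : ℝ) < n.choose (p + 1) := by exact_mod_cast Nat.choose_pos (by omega)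
    set A : ℝ := (k.choose p : ℝ) / n.choose p with hA
    set v : ℝ := (k : ℝ) / n with hv
    have hA0 : 0 ≤ A := by positivity
    have hA1 : A ≤ 1 := (div_le_one hpos).2 (by exact_mod_cast Nat.choose_le_choose p hk)
    have hv0 : 0 ≤ v := by positivity
    have hv1 : v ≤ 1 := (div_le_one hn).2 hkn
    have hnp' : (0 : ℝ) < (n : ℝ) - p := by linarith
    have hstep : (k.choose (p + 1) : ℝ) / n.choose (p + 1) = A * (((k : ℝ) - p) / (n - p)) := by
      rw [hA, div_mul_div_comm, ← hsucc, ← hsucc, mul_div_mul_right _ _ (by positivity)]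
    have hu : |((k : ℝ) - p) / (n - p) - v| ≤ p / (n - p) := by
      have : ((k : ℝ) - p) / (n - p) - v = -((p / (n - p)) * (1 - v)) := by
        rw [hv]; field_simp; ring
      rw [this, abs_neg, abs_of_nonneg (mul_nonneg (by positivity) (by linarith))]
      exact mul_le_of_le_one_right (by positivity) (by linarith)
    have hd : A * (((k : ℝ) - p) / (n - p)) - v ^ (p + 1)
        = A * (((k : ℝ) - p) / (n - p) - v) + v * (A - v ^ p) := by ring
    rw [hstep, hd]
    calc |A * (((k : ℝ) - p) / (n - p) - v) + v * (A - v ^ p)|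
        ≤ |A * (((k : ℝ) - p) / (n - p) - v)| + |v * (A - v ^ p)| := abs_add_le _ _
      _ ≤ 1 * (p / (n - p)) + 1 * (p ^ 2 / (n - p)) := by
          rw [abs_mul, abs_mul, abs_of_nonneg hA0, abs_of_nonneg hv0]
          gcongr
          exact ih (by omega)
      _ = (p ^ 2 + p) / (n - p) := by ring
      _ ≤ ((p + 1 : ℕ) : ℝ) ^ 2 / (n - (p + 1 : ℕ)) := by
          push_cast
          apply div_le_div₀ (by positivity) (by nlinarith [(Nat.cast_nonneg p : (0:ℝ) ≤ p)]) hnp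
          linarith

/-- Extraction of a limit from a sequence of measures of constant mass on a compact space. -/
lemma exists_limit_measure {E : Type*} [TopologicalSpace E] [CompactSpace E] [T2Space E]
    [MeasurableSpace E] [BorelSpace E] (ν : ℕ → Measure E) (C : ℝ≥0) (hν : ∀ n, ν n univ = C) :
    ∃ μ : Measure E, μ univ = C ∧ ∀ g : E → ℝ, Continuous g → ∀ L : ℝ,
      Tendsto (fun n => ∫ z, g z ∂(ν n)) atTop (𝓝 L) → ∫ z, g z ∂μ = L := by
  have hfin : ∀ n, IsFiniteMeasure (ν n) := fun n => ⟨by simp [hν]⟩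
  let ν' : ℕ → FiniteMeasure E := fun n => ⟨ν n, hfin n⟩
  have hmass : ∀ n, (ν' n).mass = C := fun n => by
    simp [ν', FiniteMeasure.mass, hν]
  let U : Ultrafilter ℕ := Ultrafilter.of atTop
  obtain ⟨μ, hμ, hU⟩ :=
    (isCompact_setOfPred_finiteMeasure_eq_of_compactSpace E C).ultrafilter_le_nhds (U.map ν')
      (le_principal_iff.2 (Ultrafilter.mem_map.2 (univ_mem' hmass)))
  have hlim : Tendsto ν' U (𝓝 μ) := hU
  refine ⟨μ, ?_, fun g hg L hL => ?_⟩
  · rw [← FiniteMeasure.ennreal_mass]; exact congrArg _ hμ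
  · have h1 := FiniteMeasure.tendsto_iff_forall_integral_tendsto.1 hlim
      (BoundedContinuousFunction.mkOfCompact ⟨g, hg⟩)
    exact tendsto_nhds_unique h1 (hL.mono_left (Ultrafilter.of_le atTop))

/-- **Hausdorff moment problem**, with the interval `[0, 1]` parametrised by
`z ↦ e^{-hz}`, `z ∈ [0, ∞]`. -/
lemma exists_measure_of_moments {a : ℕ → ℝ}
    (ha : ∀ n k, 0 ≤ ∑ j ∈ Finset.range (n + 1), (-1) ^ j * n.choose j * a (k + j))
    {h : ℝ≥0∞} (h0 : h ≠ 0) (ht : h ≠ ∞) :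
    ∃ μ : Measure ℝ≥0∞, μ univ = (a 0).toNNReal ∧
      ∀ p : ℕ, ∫ z, expNeg (h * z) ^ p ∂μ = a p := by
  have hw : ∀ n k, 0 ≤ bernsteinWeight a n k := fun n k =>
    mul_nonneg (by positivity) (ha (n - k) k)
  have ha0 : 0 ≤ a 0 := by simpa using ha 0 0
  have hz : ∀ n k : ℕ, ∃ z : ℝ≥0∞, k ≤ n → expNeg (h * z) = k / n := by
    intro n k
    by_cases hk : k ≤ n
    · obtain ⟨z, hz⟩ := exists_expNeg_eq (t := k / n) (by positivity)
        (div_le_one_of_le₀ (by exact_mod_cast hk) (by positivity))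
      exact ⟨h⁻¹ * z, fun _ => by rw [← mul_assoc, ENNReal.mul_inv_cancel h0 ht, one_mul, hz]⟩
    · exact ⟨0, fun h => absurd h hk⟩
  choose z hz using hz
  let ν : ℕ → Measure ℝ≥0∞ := fun n => ∑ k ∈ Finset.range (n + 1),
    ENNReal.ofReal (bernsteinWeight a n k) • Measure.dirac (z n k)
  have hsum : ∀ n, ∑ k ∈ Finset.range (n + 1), bernsteinWeight a n k = a 0 := fun n => by
    simpa using sum_choose_mul_bernsteinWeight a (Nat.zero_le n)
  have hmass : ∀ n, ν n univ = (a 0).toNNReal := fun n => by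
    simp only [ν, Measure.finsetSum_apply, Measure.smul_apply, measure_univ, smul_eq_mul, mul_one]
    rw [← ENNReal.ofReal_sum_of_nonneg fun k _ => hw n k, hsum]
    rfl
  have hint : ∀ n (g : ℝ≥0∞ → ℝ), ∫ z, g z ∂(ν n)
      = ∑ k ∈ Finset.range (n + 1), bernsteinWeight a n k * g (z n k) := fun n g => by
    simp only [ν]
    rw [integral_finsetSum_measure]
    · refine Finset.sum_congr rfl fun k _ => ?_
      rw [integral_smul_measure, integral_dirac, ENNReal.toReal_ofReal (hw n k), smul_eq_mul]
    · exact fun k _ => (integrable_dirac (by simp)).smul_measure ENNReal.ofReal_ne_top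
  obtain ⟨μ, hμ, hlim⟩ := exists_limit_measure ν _ hmass
  refine ⟨μ, hμ, fun p => hlim _ ?_ _ ?_⟩
  · exact (continuous_expNeg.comp (ENNReal.continuous_const_mul ht)).pow p
  · simp only [hint]
    rw [tendsto_iff_norm_sub_tendsto_zero]
    have hbound : ∀ᶠ n : ℕ in atTop, ‖∑ k ∈ Finset.range (n + 1),
        bernsteinWeight a n k * expNeg (h * z n k) ^ p - a p‖ ≤ a 0 * (p ^ 2 / (n - p)) := by
      filter_upwards [eventually_gt_atTop p] with n hn
      have hpos : (0 : ℝ) < n.choose p := by exact_mod_cast Nat.choose_pos hn.le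
      have h1 : a p = ∑ k ∈ Finset.range (n + 1),
          bernsteinWeight a n k * ((k.choose p : ℝ) / n.choose p) := by
        rw [eq_comm, ← mul_right_inj' hpos.ne', ← sum_choose_mul_bernsteinWeight a hn.le,
          Finset.mul_sum]
        refine Finset.sum_congr rfl fun k _ => ?_
        field_simp
      rw [h1, ← Finset.sum_sub_distrib, ← hsum n, Finset.sum_mul]
      refine (norm_sum_le _ _).trans (Finset.sum_le_sum fun k hk => ?_)
      have hk : k ≤ n := Nat.lt_succ_iff.1 (Finset.mem_range.1 hk)
      rw [hz n k hk, ← mul_sub, norm_mul, Real.norm_of_nonneg (hw n k), norm_sub_rev]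
      exact mul_le_mul_of_nonneg_left (abs_choose_div_choose_sub_pow_le hk hn) (hw n k)
    refine squeeze_zero' (.of_forall fun _ => norm_nonneg _) hbound ?_
    have : Tendsto (fun n : ℕ => (n : ℝ) - p) atTop atTop :=
      tendsto_atTop_add_const_right _ _ tendsto_natCast_atTop_atTop
    simpa using (this.const_div_atTop ((p : ℝ) ^ 2)).const_mul (a 0)

end HausdorffMoments

/-- The alternating differences of order `n` of a function on `ℝ`. -/
def altDiff (g : ℝ → ℝ) (n : ℕ) (h r : ℝ) : ℝ :=
  ∑ k ∈ Finset.range (n + 1), (-1) ^ k * n.choose k * g (r + k * h)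

/-- The class of decreasing maps `[0,∞] → [0,∞)` with nonnegative alternating differences. By
Bernstein's theorem this is the class `cm`. -/
structure IsAlternating (f : ℝ≥0∞ → ℝ) : Prop where
  antitone : Antitone f
  nonneg : ∀ u, 0 ≤ f u
  altDiff_nonneg : ∀ n : ℕ, ∀ h r : ℝ, 0 < h → 0 ≤ r →
    0 ≤ altDiff (fun r => f (ENNReal.ofReal r)) n h r

section AltDiff

lemma altDiff_zero (g : ℝ → ℝ) (h r : ℝ) : altDiff g 0 h r = g r := by simp [altDiff]

lemma altDiff_eq_fwdDiff (g : ℝ → ℝ) (n : ℕ) (h r : ℝ) :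
    altDiff g n h r = (-1) ^ n * (fwdDiff h)^[n] g r := by
  rw [fwdDiff_iter_eq_sum_shift, altDiff, Finset.mul_sum]
  refine Finset.sum_congr rfl fun k hk => ?_
  have hk : k ≤ n := Nat.lt_succ_iff.1 (Finset.mem_range.1 hk)
  have : (-1 : ℝ) ^ n * (-1) ^ (n - k) = (-1) ^ k := by
    rw [← pow_add, show n + (n - k) = 2 * (n - k) + k by omega, pow_add, pow_mul]; simp
  rw [zsmul_eq_mul, nsmul_eq_mul]
  push_cast
  rw [← this]; ring

lemma altDiff_succ (g : ℝ → ℝ) (n : ℕ) (h r : ℝ) :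
    altDiff g (n + 1) h r = altDiff (fun r => g r - g (r + h)) n h r := by
  have : (fun r => g r - g (r + h)) = -fwdDiff h g := by ext; simp [fwdDiff]
  have hneg : ∀ (n : ℕ) (u : ℝ → ℝ), (fwdDiff h)^[n] (-u) = -(fwdDiff h)^[n] u := by
    intro n
    induction n with
    | zero => simp
    | succ n ih =>
      intro u
      have : fwdDiff h (-u) = -fwdDiff h u := by ext; simp [fwdDiff]; ring
      rw [Function.iterate_succ_apply, this, ih, Function.iterate_succ_apply]
  rw [altDiff_eq_fwdDiff, altDiff_eq_fwdDiff, this, hneg, Function.iterate_succ_apply, pow_succ]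
  simp

/-- A function whose successive derivatives on `(0, ∞)` alternate in sign has nonnegative
alternating differences. -/
lemma altDiff_nonneg_of_hasDerivAt (n : ℕ) {G : ℕ → ℝ → ℝ}
    (hG : ∀ n r, 0 < r → HasDerivAt (G n) (-G (n + 1) r) r) (hG0 : ∀ n r, 0 < r → 0 ≤ G n r)
    {h r : ℝ} (hh : 0 < h) (hr : 0 < r) : 0 ≤ altDiff (G 0) n h r := by
  induction n generalizing G with
  | zero => rw [altDiff_zero]; exact hG0 0 r hr
  | succ n ih =>
    rw [altDiff_succ]
    refine ih (G := fun n r => G n r - G n (r + h)) (fun m s hs => ?_) (fun m s hs => ?_)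
    · have h1 := (hG m (s + h) (by positivity)).comp_add_const s h
      exact ((hG m s hs).sub h1).congr_deriv (by ring)
    · have hanti : AntitoneOn (G m) (Ioi 0) := by
        refine antitoneOn_of_deriv_nonpos (convex_Ioi 0)
          (fun s hs => (hG m s hs).continuousAt.continuousWithinAt) ?_ ?_
        · rw [interior_Ioi]
          exact fun s hs => (hG m s hs).differentiableAt.differentiableWithinAt
        · rw [interior_Ioi]
          intro s hs
          rw [(hG m s hs).deriv]
          simpa using hG0 (m + 1) s hs
      have := hanti (mem_Ioi.2 hs) (mem_Ioi.2 (by positivity : 0 < s + h)) (by linarith)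
      linarith

end AltDiff

namespace IsCM

variable {f : ℝ≥0∞ → ℝ}

lemma altDiff_nonneg_of_pos (hf : IsCM f) (n : ℕ) {h r : ℝ} (hh : 0 < h) (hr : 0 < r) :
    0 ≤ altDiff (fun r => f (ENNReal.ofReal r)) n h r := by
  set g : ℝ → ℝ := fun r => f (ENNReal.ofReal r) with hg
  have := altDiff_nonneg_of_hasDerivAt n
    (G := fun m r => (-1) ^ m * iteratedDerivWithin m g (Ioi 0) r) (fun m s hs => ?_)
    hf.alternating hh hr
  · simpa using this
  · have hd : DifferentiableOn ℝ (iteratedDerivWithin m g (Ioi 0)) (Ioi 0) :=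
      hf.smooth.differentiableOn_iteratedDerivWithin (by exact_mod_cast WithTop.coe_lt_top _)
        (uniqueDiffOn_Ioi 0)
    have h1 := ((hd s hs).differentiableAt (Ioi_mem_nhds hs)).hasDerivAt.const_mul ((-1 : ℝ) ^ m)
    refine h1.congr_deriv ?_
    rw [iteratedDerivWithin_succ, derivWithin_of_isOpen isOpen_Ioi hs, pow_succ]
    ring

lemma isAlternating (hf : IsCM f) : IsAlternating f := by
  refine ⟨hf.antitone, hf.nonneg, fun n h r hh hr => ?_⟩
  rcases hr.eq_or_lt with rfl | hr
  swap
  · exact hf.altDiff_nonneg_of_pos n hh hr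
  set g : ℝ → ℝ := fun r => f (ENNReal.ofReal r) with hg
  have hsplit : ∀ r, altDiff g n h r = g r + ∑ k ∈ Finset.range n,
      (-1) ^ (k + 1) * n.choose (k + 1) * g (r + (k + 1 : ℕ) * h) := fun r => by
    rw [altDiff, Finset.sum_range_succ']; simp [add_comm]
  have hlim : Tendsto (fun r => g 0 + ∑ k ∈ Finset.range n,
      (-1) ^ (k + 1) * n.choose (k + 1) * g (r + (k + 1 : ℕ) * h)) (𝓝[>] 0)
      (𝓝 (altDiff g n h 0)) := by
    rw [hsplit]
    refine (Tendsto.const_add _ (tendsto_finsetSum _ fun k _ => ?_)).mono_left nhdsWithin_le_nhds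
    have hc : ContinuousAt g (0 + (k + 1 : ℕ) * h) :=
      hf.smooth.continuousOn.continuousAt (Ioi_mem_nhds (by positivity))
    have : ContinuousAt (fun r : ℝ => g (r + (k + 1 : ℕ) * h)) 0 :=
      ContinuousAt.comp (f := fun r : ℝ => r + (k + 1 : ℕ) * h) hc (by fun_prop)
    exact this.tendsto.const_mul _
  refine ge_of_tendsto hlim ?_
  filter_upwards [self_mem_nhdsWithin] with r hr
  have h1 := hf.altDiff_nonneg_of_pos n hh hr
  rw [hsplit] at h1
  have h2 : g r ≤ g 0 := hf.antitone (ENNReal.ofReal_le_ofReal (le_of_lt hr))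
  linarith

end IsCM

namespace IsAlternating

variable {f : ℝ≥0∞ → ℝ}

lemma measurable (hf : IsAlternating f) : Measurable f := hf.antitone.measurable

lemma norm_le (hf : IsAlternating f) (x : ℝ≥0∞) : ‖f x‖ ≤ f 0 := by
  rw [Real.norm_of_nonneg (hf.nonneg x)]; exact hf.antitone zero_le

lemma integrable (hf : IsAlternating f) (μ : Measure ℝ≥0∞) [IsFiniteMeasure μ] :
    Integrable f μ :=
  .of_bound hf.measurable.aestronglyMeasurable (f 0) (.of_forall hf.norm_le)

lemma sub_const (hf : IsAlternating f) : IsAlternating fun x => f x - f ∞ := by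
  refine ⟨fun a b hab => sub_le_sub_right (hf.antitone hab) _,
    fun u => sub_nonneg.2 (hf.antitone le_top), fun n h r hh hr => ?_⟩
  have key : altDiff (fun r => f (ENNReal.ofReal r) - f ∞) n h r
      = altDiff (fun r => f (ENNReal.ofReal r)) n h r - altDiff (fun _ => f ∞) n h r := by
    simp only [altDiff, ← Finset.sum_sub_distrib, mul_sub]
  cases n with
  | zero => rw [altDiff_zero]; exact sub_nonneg.2 (hf.antitone le_top)
  | succ n =>
    have h0 : altDiff (fun _ => f ∞) (n + 1) h r = 0 := by
      rw [altDiff_succ]; simp [altDiff]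
    rw [key, h0, sub_zero]
    exact hf.altDiff_nonneg _ _ _ hh hr

/-- Nonnegative alternating differences pass to pointwise limits. -/
lemma of_tendsto {F : ℕ → ℝ≥0∞ → ℝ} (hF : ∀ n, IsAlternating (F n))
    (h : ∀ x, Tendsto (fun n => F n x) atTop (𝓝 (f x))) : IsAlternating f := by
  refine ⟨fun a b hab => le_of_tendsto_of_tendsto' (h b) (h a) fun n => (hF n).antitone hab,
    fun u => ge_of_tendsto' (h u) fun n => (hF n).nonneg u, fun n δ r hδ hr => ?_⟩
  have hlim : Tendsto (fun m => altDiff (fun r => F m (ENNReal.ofReal r)) n δ r) atTop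
      (𝓝 (altDiff (fun r => f (ENNReal.ofReal r)) n δ r)) :=
    tendsto_finsetSum _ fun k _ => (h _).const_mul _
  exact ge_of_tendsto' hlim fun m => (hF m).altDiff_nonneg n δ r hδ hr

/-- Nonnegative alternating differences pass to mixtures. -/
lemma integral {α : Type*} [MeasurableSpace α] {μ : Measure α} {F : α → ℝ≥0∞ → ℝ}
    (hF : ∀ a, IsAlternating (F a)) (hint : ∀ x, Integrable (fun a => F a x) μ) :
    IsAlternating fun x => ∫ a, F a x ∂μ := by
  refine ⟨fun a b hab => integral_mono (hint b) (hint a) fun c => (hF c).antitone hab,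
    fun u => integral_nonneg fun c => (hF c).nonneg u, fun n h r hh hr => ?_⟩
  have : altDiff (fun r => ∫ a, F a (ENNReal.ofReal r) ∂μ) n h r
      = ∫ a, altDiff (fun r => F a (ENNReal.ofReal r)) n h r ∂μ := by
    simp only [altDiff]
    rw [integral_finsetSum _ fun k _ => (hint _).const_mul _]
    exact Finset.sum_congr rfl fun k _ => (integral_const_mul _ _).symm
  rw [this]
  exact integral_nonneg fun a => (hF a).altDiff_nonneg n h r hh hr

lemma add (hf : IsAlternating f) {g : ℝ≥0∞ → ℝ} (hg : IsAlternating g) :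
    IsAlternating fun x => f x + g x := by
  refine ⟨fun a b hab => add_le_add (hf.antitone hab) (hg.antitone hab),
    fun u => add_nonneg (hf.nonneg u) (hg.nonneg u), fun n h r hh hr => ?_⟩
  have : altDiff (fun r => f (ENNReal.ofReal r) + g (ENNReal.ofReal r)) n h r
      = altDiff (fun r => f (ENNReal.ofReal r)) n h r
        + altDiff (fun r => g (ENNReal.ofReal r)) n h r := by
    simp only [altDiff, ← Finset.sum_add_distrib, mul_add]
  rw [this]
  exact add_nonneg (hf.altDiff_nonneg n h r hh hr) (hg.altDiff_nonneg n h r hh hr)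

lemma const {c : ℝ} (hc : 0 ≤ c) : IsAlternating fun _ => c := by
  refine ⟨antitone_const, fun _ => hc, fun n h r _ _ => ?_⟩
  cases n with
  | zero => rwa [altDiff_zero]
  | succ n => rw [altDiff_succ]; simp [altDiff]

variable {c₁ : ZeroTimesTop} {c₂ : TopTimesZero}

/-- The exponential functions of the left variable have nonnegative alternating differences. -/
lemma expKernel_left (y : ℝ≥0∞) : IsAlternating fun x => expKernel c₁ c₂ x y := by
  refine ⟨antitone_expKernel_left y, fun x => expKernel_nonneg x y, fun n h r hh hr => ?_⟩
  rcases eq_or_ne y ∞ with rfl | hy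
  · cases c₁
    · simp [expKernel_top_right_zeroPlus, altDiff]
    · simp only [expKernel_top_right_topMinus, ENNReal.ofReal_eq_zero, altDiff]
      rw [Finset.sum_range_succ']
      refine add_nonneg (Finset.sum_nonneg fun k _ => ?_) (by split_ifs <;> simp)
      rw [if_neg]
      · simp
      · rw [not_le]; positivity
  · have : altDiff (fun r => expKernel c₁ c₂ (ENNReal.ofReal r) y) n h r
        = Real.exp (-(r * y.toReal)) * (1 - Real.exp (-(h * y.toReal))) ^ n := by
      rw [sub_eq_neg_add, add_pow, Finset.mul_sum]
      refine Finset.sum_congr rfl fun k _ => ?_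
      simp only
      rw [expKernel_of_ne_top ENNReal.ofReal_ne_top hy, expNeg_of_ne_top (by finiteness),
        ENNReal.toReal_mul, ENNReal.toReal_ofReal (by positivity), neg_pow (Real.exp _) k,
        ← Real.exp_nat_mul,
        show -((r + k * h) * y.toReal) = -(r * y.toReal) + k * -(h * y.toReal) by ring,
        Real.exp_add]
      ring
    rw [this]
    have : Real.exp (-(h * y.toReal)) ≤ 1 := Real.exp_le_one_iff.2 (by
      have := mul_nonneg hh.le (ENNReal.toReal_nonneg (a := y)); linarith)
    exact mul_nonneg (Real.exp_nonneg _) (pow_nonneg (by linarith) _)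

end IsAlternating

section Bernstein

variable {f : ℝ≥0∞ → ℝ}

lemma continuous_expNeg_mul {x : ℝ≥0∞} (hx : x ≠ ∞) : Continuous fun z => expNeg (x * z) :=
  continuous_expNeg.comp (ENNReal.continuous_const_mul hx)

lemma integrable_expNeg_mul (μ : Measure ℝ≥0∞) [IsFiniteMeasure μ] (x : ℝ≥0∞) :
    Integrable (fun z => expNeg (x * z)) μ :=
  .of_bound (measurable_expNeg.comp (by fun_prop)).aestronglyMeasurable 1 (.of_forall fun z => by
    rw [Real.norm_of_nonneg (expNeg_nonneg _)]; exact expNeg_le_one _)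

lemma continuousOn_integral_expNeg_ofReal (μ : Measure ℝ≥0∞) [IsFiniteMeasure μ] :
    ContinuousOn (fun r : ℝ => ∫ z, expNeg (ENNReal.ofReal r * z) ∂μ) (Ioi 0) := by
  refine continuousOn_of_dominated (bound := fun _ => 1) (fun r _ =>
    (integrable_expNeg_mul μ _).aestronglyMeasurable) (fun r _ => .of_forall fun z => ?_)
    (integrable_const _) (.of_forall fun z => ?_)
  · rw [Real.norm_of_nonneg (expNeg_nonneg _)]; exact expNeg_le_one _
  · intro r hr
    refine (continuous_expNeg.continuousAt.comp ?_).continuousWithinAt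
    exact ENNReal.Tendsto.mul_const (ENNReal.continuous_ofReal.tendsto r)
      (Or.inl (by simpa using hr))

/-- **Bernstein's theorem** on the lattice of multiples of `h`. -/
lemma IsAlternating.exists_measure_natCast_mul (hf : IsAlternating f) {h : ℝ} (hh : 0 < h) :
    ∃ μ : Measure ℝ≥0∞, μ univ = (f 0).toNNReal ∧ ∀ p : ℕ, 0 < p →
      ∫ z, expNeg (ENNReal.ofReal (p * h) * z) ∂μ = f (ENNReal.ofReal (p * h)) := by
  have ha : ∀ n k : ℕ, 0 ≤ ∑ j ∈ Finset.range (n + 1),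
      (-1) ^ j * n.choose j * f (ENNReal.ofReal ((k + j : ℕ) * h)) := fun n k => by
    simpa [altDiff, add_mul] using hf.altDiff_nonneg n h (k * h) hh (by positivity)
  obtain ⟨μ, hμ, hp⟩ := exists_measure_of_moments
    (a := fun k : ℕ => f (ENNReal.ofReal (k * h))) ha (h := ENNReal.ofReal h) (by simpa using hh)
    ENNReal.ofReal_ne_top
  refine ⟨μ, by simpa using hμ, fun p _ => ?_⟩
  rw [← hp p]
  congr with z
  rw [← expNeg_natCast_mul, ← mul_assoc, ENNReal.ofReal_mul (by positivity),
    ENNReal.ofReal_natCast]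

/-- **Bernstein's theorem**: a function with nonnegative alternating differences is on `(0, ∞)`
the Laplace transform of a measure of mass `f 0` on `[0, ∞]`. -/
theorem IsAlternating.exists_measure (hf : IsAlternating f) :
    ∃ μ : Measure ℝ≥0∞, μ univ = (f 0).toNNReal ∧ ∀ r : ℝ, 0 < r →
      ∫ z, expNeg (ENNReal.ofReal r * z) ∂μ = f (ENNReal.ofReal r) := by
  choose ν hν hνf using fun m : ℕ =>
    hf.exists_measure_natCast_mul (h := ((m.factorial : ℝ))⁻¹) (by positivity)
  obtain ⟨μ, hμ, hlim⟩ := exists_limit_measure ν _ hν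
  have hfin : IsFiniteMeasure μ := ⟨by simp [hμ]⟩
  have hrat : ∀ q : ℚ, 0 < q →
      ∫ z, expNeg (ENNReal.ofReal q * z) ∂μ = f (ENNReal.ofReal q) := by
    intro q hq
    refine hlim _ (continuous_expNeg_mul ENNReal.ofReal_ne_top) _ ?_
    refine tendsto_const_nhds.congr' ?_
    filter_upwards [eventually_ge_atTop q.den] with m hm
    obtain ⟨d, hd⟩ := Nat.dvd_factorial q.den_pos hm
    have hnum : 0 < q.num := Rat.num_pos.2 hq
    have hdpos : 0 < d := Nat.pos_of_mul_pos_left (hd ▸ m.factorial_pos)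
    have key : (q : ℝ) = ((q.num.toNat * d : ℕ) : ℝ) * (m.factorial : ℝ)⁻¹ := by
      have hq' : (q : ℝ) = (q.num.toNat : ℝ) / q.den := by
        have h1 : ((q.num.toNat : ℤ) : ℝ) = (q.num : ℝ) := by rw [Int.toNat_of_nonneg hnum.le]
        rw [Rat.cast_def, ← h1, Int.cast_natCast]
      have hden : (q.den : ℝ) ≠ 0 := by exact_mod_cast q.den_nz
      have hd' : (d : ℝ) ≠ 0 := by exact_mod_cast hdpos.ne'
      rw [hq', hd]
      push_cast
      field_simp
    rw [key]
    exact (hνf m _ (Nat.mul_pos (by omega) hdpos)).symm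
  refine ⟨μ, hμ, fun r hr => ?_⟩
  have hcont := (continuousOn_integral_expNeg_ofReal μ).continuousAt (Ioi_mem_nhds hr)
  refine le_antisymm ?_ ?_
  · by_contra! hlt
    obtain ⟨ε, hε, hball⟩ := Metric.eventually_nhds_iff.1 (hcont.eventually (lt_mem_nhds hlt))
    obtain ⟨q, hq1, hq2⟩ := exists_rat_btwn (show r < r + ε by linarith)
    have h1 := hball (show dist (q : ℝ) r < ε by rw [Real.dist_eq, abs_lt]; constructor <;> linarith)
    rw [hrat q (by exact_mod_cast hr.trans hq1)] at h1
    exact h1.not_ge (hf.antitone (ENNReal.ofReal_le_ofReal hq1.le))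
  · by_contra! hlt
    obtain ⟨ε, hε, hball⟩ := Metric.eventually_nhds_iff.1 (hcont.eventually (gt_mem_nhds hlt))
    obtain ⟨q, hq1, hq2⟩ := exists_rat_btwn (show max 0 (r - ε) < r by simp [hr, hε])
    have hq0 : 0 < (q : ℝ) := (le_max_left _ _).trans_lt hq1
    have hq1 : r - ε < q := (le_max_right _ _).trans_lt hq1
    have h1 := hball (show dist (q : ℝ) r < ε by rw [Real.dist_eq, abs_lt]; constructor <;> linarith)
    rw [hrat q (by exact_mod_cast hq0)] at h1
    exact h1.not_ge (hf.antitone (ENNReal.ofReal_le_ofReal hq2.le))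

/-- A function with nonnegative alternating differences is a mixture of exponentials, up to a
constant, on the whole of `[0, ∞]`. -/
lemma IsAlternating.exists_expKernel (hf : IsAlternating f) :
    ∃ μ : Measure ℝ≥0∞, μ univ = (f 0 - f ∞).toNNReal ∧ ∀ x,
      f x = ∫ z, expKernel .topMinus .zeroPlus x z ∂μ + f ∞ := by
  obtain ⟨μ, hμ, hr⟩ := hf.sub_const.exists_measure
  refine ⟨μ, hμ, fun x => ?_⟩
  rcases eq_or_ne x ∞ with rfl | hx
  · simp [expKernel_top_left_zeroPlus]
  rcases eq_or_ne x 0 with rfl | hx0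
  · simp only [expKernel_zero_left_topMinus]
    have h := hf.sub_const.nonneg 0
    simp [measureReal_def, hμ, h]
  · have := hr x.toReal (ENNReal.toReal_pos hx0 hx)
    rw [ENNReal.ofReal_toReal hx] at this
    simp only [expKernel_of_left hx0 hx, this]
    ring

/-- Laplace transforms of finite measures on `[0, ∞]` are completely monotone on `(0, ∞)`. -/
lemma IsCM.of_laplace (hanti : Antitone f) (hf0 : ∀ u, 0 ≤ f u) (μ : Measure ℝ≥0∞)
    [IsFiniteMeasure μ] (hr : ∀ r : ℝ, 0 < r →
      f (ENNReal.ofReal r) = ∫ z, expNeg (ENNReal.ofReal r * z) ∂μ) : IsCM f := by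
  set ν := μ.restrict {∞}ᶜ with hν
  set Z : ℝ≥0∞ → ℝ := fun z => -z.toReal with hZ
  have hZm : Measurable Z := ENNReal.measurable_toReal.neg
  have hmgf : ∀ r ∈ Ioi (0 : ℝ), f (ENNReal.ofReal r) = mgf Z ν r := by
    intro r hr'
    rw [hr r hr', mgf, hν, ← integral_indicator (measurableSet_singleton ∞).compl]
    refine integral_congr_ae (.of_forall fun z => ?_)
    by_cases hz : z = ∞
    · have : ENNReal.ofReal r ≠ 0 := by simpa using hr'
      simp [hz, this]
    · simp only
      rw [indicator_of_mem hz, expNeg_of_ne_top (by finiteness), ENNReal.toReal_mul,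
        ENNReal.toReal_ofReal (le_of_lt hr'), hZ]
      simp
  have hint : Ioi (0 : ℝ) ⊆ interior (integrableExpSet Z ν) := by
    refine interior_maximal (fun r hr' => ?_) isOpen_Ioi
    refine .of_bound (by fun_prop) 1 (.of_forall fun z => ?_)
    rw [Real.norm_of_nonneg (Real.exp_nonneg _)]
    refine Real.exp_le_one_iff.2 ?_
    have := mul_nonneg (le_of_lt hr') (ENNReal.toReal_nonneg (a := z))
    simp only [hZ]; linarith
  refine ⟨hanti, hf0, ?_, fun n r hr' => ?_⟩
  · refine ContDiffOn.congr ?_ hmgf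
    exact ((analyticOnNhd_mgf.mono hint).contDiffOn (uniqueDiffOn_Ioi 0))
  · rw [iteratedDerivWithin_congr hmgf hr', iteratedDerivWithin_of_isOpen isOpen_Ioi hr',
      iteratedDeriv_mgf (hint hr'), ← integral_const_mul]
    refine integral_nonneg fun z => ?_
    simp only [Pi.zero_apply, hZ]
    rw [← mul_assoc, ← mul_pow]
    simp only [neg_mul, mul_neg, one_mul, neg_neg]
    positivity

lemma IsAlternating.isCM (hf : IsAlternating f) : IsCM f := by
  obtain ⟨μ, hμ, hr⟩ := hf.exists_measure
  have : IsFiniteMeasure μ := ⟨by simp [hμ]⟩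
  exact IsCM.of_laplace hf.antitone hf.nonneg μ fun r h => (hr r h).symm

end Bernstein

section Density

/-- The exponentials `x ↦ e^{-xy}`, `y ∈ [0, ∞)`, as a multiplicative submonoid of the continuous
functions on `[0, ∞]`. -/
noncomputable def expSubmonoid : Submonoid C(ℝ≥0∞, ℝ) where
  carrier := {g | ∃ y : ℝ≥0∞, y ≠ ∞ ∧ ∀ x, g x = expNeg (x * y)}
  one_mem' := ⟨0, by simp, by simp⟩
  mul_mem' := by
    rintro g g' ⟨y, hy, h⟩ ⟨y', hy', h'⟩
    exact ⟨y + y', by finiteness, fun x => by simp [h, h', mul_add, expNeg_add]⟩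

lemma dense_span_expSubmonoid :
    (Submodule.span ℝ (expSubmonoid : Set C(ℝ≥0∞, ℝ))).topologicalClosure = ⊤ := by
  have hsep : (Algebra.adjoin ℝ (expSubmonoid : Set C(ℝ≥0∞, ℝ))).SeparatesPoints := by
    intro x x' hxx'
    refine ⟨fun x => expNeg (x * 1), ⟨⟨fun x => expNeg (x * 1), ?_⟩,
      Algebra.subset_adjoin ⟨1, by simp, fun _ => rfl⟩, rfl⟩, ?_⟩
    · simpa using continuous_expNeg
    · simpa using expNeg_strictAnti.injective.ne hxx'
  have h := ContinuousMap.subalgebra_topologicalClosure_eq_top_of_separatesPoints _ hsep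
  have h2 := congrArg Subalgebra.toSubmodule h
  rw [Algebra.top_toSubmodule] at h2
  rw [← h2, eq_comm]
  apply SetLike.coe_injective
  have h3 := Algebra.adjoin_eq_span (R := ℝ) (expSubmonoid : Set C(ℝ≥0∞, ℝ))
  rw [Submonoid.closure_eq] at h3
  rw [← h3]
  rfl

/-- A property of continuous functions on `[0, ∞]` that is stable under linear combinations and
uniform limits and holds for exponentials holds for all of them. -/
theorem expNeg_induction {p : (ℝ≥0∞ → ℝ) → Prop}
    (exp : ∀ y, y ≠ ∞ → p fun x => expNeg (x * y))
    (add : ∀ f g, Continuous f → Continuous g → p f → p g → p fun x => f x + g x)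
    (smul : ∀ (c : ℝ) f, Continuous f → p f → p fun x => c * f x)
    (lim : ∀ f, Continuous f →
      (∀ ε > 0, ∃ g, Continuous g ∧ p g ∧ ∀ x, |f x - g x| ≤ ε) → p f)
    (f : ℝ≥0∞ → ℝ) (hf : Continuous f) : p f := by
  have hspan : ∀ g ∈ Submodule.span ℝ (expSubmonoid : Set C(ℝ≥0∞, ℝ)), p g := by
    intro g hg
    induction hg using Submodule.span_induction with
    | mem g hg =>
      obtain ⟨y, hy, h⟩ := hg
      rw [show (g : ℝ≥0∞ → ℝ) = fun x => expNeg (x * y) from funext h]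
      exact exp y hy
    | zero =>
      have h := smul 0 (fun x => expNeg (x * 0)) (by simp [continuous_const]) (exp 0 (by simp))
      simp only [zero_mul] at h
      exact h
    | add g g' _ _ h h' => exact add _ _ g.continuous g'.continuous h h'
    | smul c g _ h => exact smul c _ g.continuous h
  refine lim f hf fun ε hε => ?_
  have hmem : (⟨f, hf⟩ : C(ℝ≥0∞, ℝ)) ∈
      closure (Submodule.span ℝ (expSubmonoid : Set C(ℝ≥0∞, ℝ)) : Set C(ℝ≥0∞, ℝ)) := by
    rw [← Submodule.topologicalClosure_coe, dense_span_expSubmonoid]; trivial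
  obtain ⟨g, hg, hd⟩ := Metric.mem_closure_iff.1 hmem ε hε
  exact ⟨g, g.continuous, hspan g hg, fun x => by
    simpa [Real.dist_eq] using (ContinuousMap.dist_apply_le_dist x).trans hd.le⟩

lemma integrable_of_continuous {f : ℝ≥0∞ → ℝ} (hf : Continuous f) (μ : Measure ℝ≥0∞)
    [IsFiniteMeasure μ] : Integrable f μ :=
  (BoundedContinuousFunction.mkOfCompact ⟨f, hf⟩).integrable μ

lemma abs_integral_sub_integral_le {f g : ℝ≥0∞ → ℝ} (hf : Continuous f) (hg : Continuous g)
    {ε : ℝ} (h : ∀ x, |f x - g x| ≤ ε) (μ : Measure ℝ≥0∞) [IsFiniteMeasure μ] :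
    |∫ x, f x ∂μ - ∫ x, g x ∂μ| ≤ ε * μ.real univ := by
  rw [← integral_sub (integrable_of_continuous hf μ) (integrable_of_continuous hg μ)]
  exact norm_integral_le_of_norm_le_const (f := fun x => f x - g x) (.of_forall h)

/-- Convergence of Laplace transforms implies weak convergence on `[0, ∞]`. -/
theorem tendsto_integral_of_tendsto_expNeg {α : Type*} {l : Filter α} {m : α → Measure ℝ≥0∞}
    [∀ a, IsFiniteMeasure (m a)] {μ : Measure ℝ≥0∞} [IsFiniteMeasure μ] {C : ℝ}
    (hm : ∀ a, (m a).real univ ≤ C)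
    (h : ∀ y, y ≠ ∞ → Tendsto (fun a => ∫ x, expNeg (x * y) ∂(m a)) l
      (𝓝 (∫ x, expNeg (x * y) ∂μ))) {f : ℝ≥0∞ → ℝ} (hf : Continuous f) :
    Tendsto (fun a => ∫ x, f x ∂(m a)) l (𝓝 (∫ x, f x ∂μ)) := by
  refine expNeg_induction (p := fun f => Tendsto (fun a => ∫ x, f x ∂(m a)) l (𝓝 (∫ x, f x ∂μ)))
    h ?_ ?_ ?_ f hf
  · intro f g hf hg h1 h2
    simp only [integral_add (integrable_of_continuous hf _) (integrable_of_continuous hg _)]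
    exact h1.add h2
  · intro c f _ h1
    simp only [integral_const_mul]
    exact h1.const_mul c
  · intro f hf happ
    rw [Metric.tendsto_nhds]
    intro ε hε
    set D : ℝ := |C| + μ.real univ + 1 with hD
    have hDpos : 0 < D := by positivity
    obtain ⟨g, hg, hpg, hfg⟩ := happ (ε / (2 * D)) (by positivity)
    filter_upwards [Metric.tendsto_nhds.1 hpg (ε / 2) (by positivity)] with a ha
    have h1 := abs_integral_sub_integral_le hf hg hfg (m a)
    have h2 := abs_integral_sub_integral_le hf hg hfg μ
    have h3 : (m a).real univ ≤ |C| := (hm a).trans (le_abs_self C)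
    have h4 : ε / (2 * D) * (m a).real univ + ε / (2 * D) * μ.real univ < ε / 2 := by
      have : (m a).real univ + μ.real univ < D := by rw [hD]; linarith
      calc _ = ε / (2 * D) * ((m a).real univ + μ.real univ) := by ring
        _ < ε / (2 * D) * D := by gcongr
        _ = ε / 2 := by field_simp
    rw [Real.dist_eq] at ha ⊢
    rw [abs_lt] at ha ⊢
    rw [abs_le] at h1 h2
    constructor <;> linarith [h1.1, h1.2, h2.1, h2.2, ha.1, ha.2]

/-- A finite measure on `[0, ∞]` is determined by its Laplace transform. -/
theorem measure_ext_of_expNeg {μ ν : Measure ℝ≥0∞} [IsFiniteMeasure μ] [IsFiniteMeasure ν]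
    (h : ∀ y, y ≠ ∞ → ∫ x, expNeg (x * y) ∂μ = ∫ x, expNeg (x * y) ∂ν) : μ = ν := by
  refine ext_of_forall_integral_eq_of_IsFiniteMeasure fun f => ?_
  have := tendsto_integral_of_tendsto_expNeg (l := (atTop : Filter ℕ)) (m := fun _ => μ) (μ := ν)
    (fun _ => le_rfl) (fun y hy => by rw [h y hy]; exact tendsto_const_nhds) f.continuous
  exact tendsto_nhds_unique tendsto_const_nhds this

/-- Measurability of a family of probability measures on `[0, ∞]` can be tested on Laplace
transforms. -/
theorem measurable_of_measurable_expNeg {α : Type*} [MeasurableSpace α] {m : α → Measure ℝ≥0∞}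
    [∀ a, IsProbabilityMeasure (m a)]
    (h : ∀ y, y ≠ ∞ → Measurable fun a => ∫ x, expNeg (x * y) ∂(m a)) : Measurable m := by
  have hcont : ∀ f : ℝ≥0∞ → ℝ, Continuous f → Measurable fun a => ∫ x, f x ∂(m a) := by
    refine expNeg_induction h ?_ ?_ ?_
    · intro f g hf hg h1 h2
      simp only [integral_add (integrable_of_continuous hf _) (integrable_of_continuous hg _)]
      exact h1.add h2
    · intro c f _ h1
      simp only [integral_const_mul]
      exact h1.const_mul c
    · intro f hf happ
      choose g hg hpg hfg using fun n : ℕ => happ (1 / (n + 1 : ℝ)) (by positivity)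
      refine measurable_of_tendsto_metrizable hpg (tendsto_pi_nhds.2 fun a => ?_)
      rw [tendsto_iff_norm_sub_tendsto_zero]
      refine squeeze_zero (fun _ => norm_nonneg _) (fun n => ?_)
        tendsto_one_div_add_atTop_nhds_zero_nat
      have := abs_integral_sub_integral_le hf (hg n) (hfg n) (m a)
      rw [norm_sub_rev, Real.norm_eq_abs]
      simpa using this
  refine Measurable.measure_of_isPiSystem_of_isProbabilityMeasure
    (BorelSpace.measurable_eq.trans borel_eq_generateFrom_isClosed) isPiSystem_isClosed
    fun F hF => ?_
  refine measurable_of_tendsto_metrizable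
    (f := fun n a => ∫⁻ x, (hF.apprSeq n x : ℝ≥0∞) ∂(m a)) (fun n => ?_)
    (tendsto_pi_nhds.2 fun a => HasOuterApproxClosed.tendsto_lintegral_apprSeq hF (m a))
  have hc : Continuous fun x => (hF.apprSeq n x : ℝ) :=
    NNReal.continuous_coe.comp (hF.apprSeq n).continuous
  convert (hcont _ hc).ennreal_ofReal using 2 with a
  rw [ofReal_integral_eq_lintegral_ofReal (integrable_of_continuous hc _)
    (.of_forall fun x => NNReal.coe_nonneg _)]
  simp

end Density

lemma integral_bind_kernel {α β : Type*} [MeasurableSpace α] [MeasurableSpace β] (μ : Measure α)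
    [SFinite μ] (κ : Kernel α β) [IsSFiniteKernel κ] {g : β → ℝ} (hg : Integrable g (μ.bind κ)) :
    ∫ z, g z ∂(μ.bind κ) = ∫ w, ∫ z, g z ∂(κ w) ∂μ := by
  have h : (κ ∘ₖ Kernel.const Unit μ) () = μ.bind κ := by
    rw [Kernel.comp_apply, Kernel.const_apply]
  rw [← h] at hg ⊢
  rw [Kernel.integral_comp hg, Kernel.const_apply]

namespace PositiveMarkovProcess

section Semigroup

variable (Z : PositiveMarkovProcess.{u}) (t : ℝ≥0)

instance (x : ℝ≥0∞) : IsProbabilityMeasure (Z.trans t x) :=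
  Measure.isProbabilityMeasure_map (Z.measurable_X t).aemeasurable

lemma trans_apply (x : ℝ≥0∞) {A : Set ℝ≥0∞} (hA : MeasurableSet A) :
    Z.trans t x A = Z.P x (Z.X t ⁻¹' A) := Measure.map_apply (Z.measurable_X t) hA

lemma measurable_trans : Measurable (Z.trans t) := by
  refine Measure.measurable_of_measurable_coe _ fun A hA => ?_
  simp_rw [Z.trans_apply t _ hA]
  exact Z.measurable_P t A hA

/-- The transition law as a kernel. -/
noncomputable def transKernel : Kernel ℝ≥0∞ ℝ≥0∞ := ⟨Z.trans t, Z.measurable_trans t⟩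

instance : IsMarkovKernel (Z.transKernel t) :=
  ⟨fun x => inferInstanceAs (IsProbabilityMeasure (Z.trans t x))⟩

lemma integral_comp_X (x : ℝ≥0∞) {g : ℝ≥0∞ → ℝ} (hg : Measurable g) :
    ∫ ω, g (Z.X t ω) ∂(Z.P x) = Z.semigroup t g x :=
  (integral_map (Z.measurable_X t).aemeasurable hg.aestronglyMeasurable).symm

lemma trans_zero (x : ℝ≥0∞) : Z.trans 0 x = Measure.dirac x := by
  have hmem : ∀ᵐ ω ∂(Z.P x), Z.X 0 ω = x :=
    (prob_compl_eq_zero_iff (Z.measurable_X 0 (measurableSet_singleton x))).2 (Z.normal x)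
  rw [trans, Measure.map_congr (g := fun _ => x) hmem, Measure.map_const]
  simp

/-- The Chapman-Kolmogorov equation. -/
lemma trans_add (s : ℝ≥0) (x : ℝ≥0∞) :
    Z.trans (s + t) x = (Z.trans s x).bind (Z.trans t) := by
  ext A hA
  have hle : (⨆ u ∈ Set.Iic s, MeasurableSpace.comap (Z.X u) inferInstance) ≤ Z.mΩ :=
    iSup₂_le fun u _ => (Z.measurable_X u).comap_le
  have hAm : MeasurableSet (Z.X (s + t) ⁻¹' A) := Z.measurable_X _ hA
  have h := integral_congr_ae (Z.markov s (s + t) le_self_add A hA x)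
  rw [integral_condExp hle, add_tsub_cancel_left] at h
  have hk : Measurable fun w => Z.trans t w A := (Z.transKernel t).measurable_coe hA
  have h1 : ∫ ω, (Z.P (Z.X s ω)).real (Z.X t ⁻¹' A) ∂(Z.P x)
      = (∫⁻ w, Z.trans t w A ∂(Z.trans s x)).toReal := by
    have hks : Measurable fun ω => Z.trans t (Z.X s ω) A := hk.comp (Z.measurable_X s)
    rw [trans, lintegral_map hk (Z.measurable_X s), ← integral_toReal hks.aemeasurable
      (.of_forall fun _ => measure_lt_top _ _)]
    simp [measureReal_def, Z.trans_apply t _ hA]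
  rw [h1] at h
  simp only [integral_indicator_const _ hAm, smul_eq_mul, mul_one, measureReal_def] at h
  rw [Measure.bind_apply hA (Z.measurable_trans t).aemeasurable, Z.trans_apply _ _ hA]
  refine (ENNReal.toReal_eq_toReal_iff' (measure_ne_top _ _) ?_).1 h
  exact ne_top_of_le_ne_top ENNReal.one_ne_top
    ((lintegral_mono fun _ => prob_le_one).trans_eq (by simp))

lemma semigroup_add (s : ℝ≥0) (x : ℝ≥0∞) {g : ℝ≥0∞ → ℝ}
    (hg : Integrable g (Z.trans (s + t) x)) :
    Z.semigroup (s + t) g x = Z.semigroup s (Z.semigroup t g) x := by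
  rw [semigroup, Z.trans_add] at *
  exact integral_bind_kernel _ (Z.transKernel t) hg

end Semigroup

section Duality

variable {c₁ : ZeroTimesTop} {c₂ : TopTimesZero} {X : PositiveMarkovProcess.{u}}
  {Y : PositiveMarkovProcess.{v}}

lemma laplaceDual_iff : X.LaplaceDual c₁ c₂ Y ↔ ∀ t x y,
    X.semigroup t (fun u => expKernel c₁ c₂ u y) x = ∫ z, expKernel c₁ c₂ x z ∂(Y.trans t y) := by
  refine forall₃_congr fun t x y => ?_
  rw [X.integral_comp_X t x (measurable_expKernel_left y),
    Y.integral_comp_X t y (measurable_expKernel_right x)]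
  rfl

lemma LaplaceDual.symm (h : X.LaplaceDual c₁ c₂ Y) : Y.LaplaceDual c₂.swap c₁.swap X := by
  intro t y x
  simp only [expKernel_swap]
  exact (h t x y).symm

lemma tendsto_expKernel_natCast (u : ℝ≥0∞) :
    Tendsto (fun n : ℕ => expKernel .topMinus c₂ u ((n : ℝ≥0∞) + 1)) atTop
      (𝓝 (expKernel .topMinus c₂ u ∞)) := by
  have h : ∀ n : ℕ, expKernel .topMinus c₂ u ((n : ℝ≥0∞) + 1) = expNeg u ^ (n + 1) := fun n => by
    rw [expKernel_of_right (by simp) (by finiteness), mul_comm, ← Nat.cast_succ,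
      expNeg_natCast_mul]
  simp only [h, expKernel_top_right_topMinus]
  rcases eq_or_ne u 0 with rfl | hu
  · simp
  · rw [if_neg hu]
    refine (tendsto_add_atTop_iff_nat 1).2
      (tendsto_pow_atTop_nhds_zero_of_lt_one (expNeg_nonneg u) ?_)
    simpa using expNeg_strictAnti (pos_iff_ne_zero.2 hu)

lemma tendsto_expKernel_inv_natCast (u : ℝ≥0∞) :
    Tendsto (fun n : ℕ => expKernel c₁ .zeroPlus u ((n : ℝ≥0∞) + 1)⁻¹) atTop
      (𝓝 (expKernel c₁ .zeroPlus u 0)) := by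
  have h : ∀ n : ℕ, expKernel c₁ .zeroPlus u ((n : ℝ≥0∞) + 1)⁻¹ = expNeg (u * ((n : ℝ≥0∞) + 1)⁻¹) :=
    fun n => expKernel_of_right (by simp) (by simp) u
  simp only [h, expKernel_zero_right_zeroPlus]
  rcases eq_or_ne u ∞ with rfl | hu
  · simp [ENNReal.top_mul]
  · have h1 : Tendsto (fun n : ℕ => u * ((n : ℝ≥0∞) + 1)⁻¹) atTop (𝓝 (u * 0)) := by
      refine ENNReal.Tendsto.const_mul ?_ (Or.inr hu)
      exact_mod_cast (tendsto_add_atTop_iff_nat 1).2 ENNReal.tendsto_inv_nat_nhds_zero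
    rw [if_neg hu]
    simpa [Function.comp_def] using (continuous_expNeg.tendsto _).comp h1

lemma LaplaceDual.isAlternating_semigroup (h : X.LaplaceDual c₁ c₂ Y) (t : ℝ≥0) (z : ℝ≥0∞) :
    IsAlternating (X.semigroup t fun u => expKernel .topMinus .zeroPlus u z) := by
  have hmid : ∀ z : ℝ≥0∞, z ≠ 0 → z ≠ ∞ →
      IsAlternating (X.semigroup t fun u => expKernel .topMinus .zeroPlus u z) := by
    intro z h0 ht
    have : X.semigroup t (fun u => expKernel .topMinus .zeroPlus u z)
        = fun x => ∫ w, expKernel c₁ c₂ x w ∂(Y.trans t z) := by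
      funext x
      rw [← laplaceDual_iff.1 h t x z]
      simp only [expKernel_of_right h0 ht]
    rw [this]
    exact IsAlternating.integral (fun w => IsAlternating.expKernel_left w)
      fun x => integrable_expKernel_right _ x
  have hlim : ∀ (w : ℕ → ℝ≥0∞), (∀ n, w n ≠ 0) → (∀ n, w n ≠ ∞) →
      (∀ u, Tendsto (fun n => expKernel .topMinus .zeroPlus u (w n)) atTop
        (𝓝 (expKernel .topMinus .zeroPlus u z))) →
      IsAlternating (X.semigroup t fun u => expKernel .topMinus .zeroPlus u z) := by
    intro w h0 ht hw
    refine IsAlternating.of_tendsto (fun n => hmid (w n) (h0 n) (ht n)) fun x => ?_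
    exact tendsto_integral_of_dominated_convergence (fun _ => 1)
      (fun n => (measurable_expKernel_left _).aestronglyMeasurable) (integrable_const _)
      (fun n => .of_forall fun u => norm_expKernel_le _ _) (.of_forall hw)
  rcases eq_or_ne z 0 with rfl | h0
  · exact hlim (fun n => ((n : ℝ≥0∞) + 1)⁻¹) (by simp) (by simp) tendsto_expKernel_inv_natCast
  rcases eq_or_ne z ∞ with rfl | ht
  · exact hlim (fun n => (n : ℝ≥0∞) + 1) (by simp) (by simp) tendsto_expKernel_natCast
  exact hmid z h0 ht

/-- A process with a Laplace dual is completely monotone. -/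
theorem LaplaceDual.completelyMonotone (h : X.LaplaceDual c₁ c₂ Y) : X.CompletelyMonotone := by
  intro t f hf
  obtain ⟨μ, hμ, hfμ⟩ := hf.isAlternating.exists_expKernel
  have : IsFiniteMeasure μ := ⟨by simp [hμ]⟩
  have hint : ∀ x, Integrable (fun p : ℝ≥0∞ × ℝ≥0∞ => expKernel .topMinus .zeroPlus p.1 p.2)
      ((X.trans t x).prod μ) := fun x =>
    .of_bound (measurable_expKernel _ _).aestronglyMeasurable 1
      (.of_forall fun p => norm_expKernel_le _ _)
  have key : X.semigroup t f = fun x =>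
      ∫ z, X.semigroup t (fun u => expKernel .topMinus .zeroPlus u z) x ∂μ + f ∞ := by
    funext x
    rw [semigroup, integral_congr_ae (.of_forall hfμ), integral_add (hint x).integral_prod_left (integrable_const _),
      integral_integral_swap (hint x)]
    simp [semigroup]
  rw [key]
  refine (IsAlternating.add (IsAlternating.integral (fun z => h.isAlternating_semigroup t z)
    fun x => (hint x).integral_prod_right) (IsAlternating.const (hf.nonneg ∞))).isCM

lemma isCM_expKernel_left (y : ℝ≥0∞) : IsCM fun x => expKernel c₁ c₂ x y :=
  (IsAlternating.expKernel_left y).isCM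

end Duality

end PositiveMarkovProcess

/-- The behaviour at `0` of the Laplace transform of a probability measure on `[0, ∞]`, depending
on the convention for `0 · ∞`. -/
def ZeroTimesTop.Boundary : ZeroTimesTop → (ℝ≥0∞ → ℝ) → Prop
  | .zeroPlus, f => Tendsto f (𝓝[>] 0) (𝓝 (f 0))
  | .topMinus, f => f 0 = 1

/-- The behaviour at `∞` of the Laplace transform of a probability measure on `[0, ∞]`, depending
on the convention for `∞ · 0`. -/
def TopTimesZero.Boundary : TopTimesZero → (ℝ≥0∞ → ℝ) → Prop
  | .zeroPlus, f => f ∞ = 0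
  | .topMinus, f => Tendsto f (𝓝[<] ∞) (𝓝 (f ∞))

section Boundary

variable {c₁ : ZeroTimesTop} {c₂ : TopTimesZero}

instance neBot_nhdsLT_top : (𝓝[<] (∞ : ℝ≥0∞)).NeBot := nhdsLT_neBot_of_exists_lt ⟨0, by simp⟩

instance neBot_nhdsGT_zero : (𝓝[>] (0 : ℝ≥0∞)).NeBot := nhdsGT_neBot_of_exists_gt ⟨∞, by simp⟩

lemma eventually_nhdsGT_zero : ∀ᶠ x : ℝ≥0∞ in 𝓝[>] 0, x ≠ 0 ∧ x ≠ ∞ := by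
  filter_upwards [self_mem_nhdsWithin,
    nhdsWithin_le_nhds (Iio_mem_nhds ENNReal.zero_lt_top)] with x hx hx'
  exact ⟨(mem_Ioi.1 hx).ne', (mem_Iio.1 hx').ne⟩

lemma eventually_nhdsLT_top : ∀ᶠ x : ℝ≥0∞ in 𝓝[<] ∞, x ≠ 0 ∧ x ≠ ∞ := by
  filter_upwards [self_mem_nhdsWithin,
    nhdsWithin_le_nhds (Ioi_mem_nhds ENNReal.zero_lt_top)] with x hx hx'
  exact ⟨(mem_Ioi.1 hx').ne', (mem_Iio.1 hx).ne⟩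

lemma tendsto_integral_expKernel (μ : Measure ℝ≥0∞) [IsFiniteMeasure μ] {l : Filter ℝ≥0∞}
    [l.IsCountablyGenerated] {g : ℝ≥0∞ → ℝ}
    (h : ∀ z, Tendsto (fun x => expKernel c₁ c₂ x z) l (𝓝 (g z))) :
    Tendsto (fun x => ∫ z, expKernel c₁ c₂ x z ∂μ) l (𝓝 (∫ z, g z ∂μ)) :=
  tendsto_integral_filter_of_dominated_convergence (fun _ => 1)
    (.of_forall fun x => (measurable_expKernel_right x).aestronglyMeasurable)
    (.of_forall fun x => .of_forall fun z => norm_expKernel_le x z) (integrable_const _)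
    (.of_forall h)

lemma tendsto_expKernel_zero (z : ℝ≥0∞) :
    Tendsto (fun x => expKernel c₁ c₂ x z) (𝓝[>] 0) (𝓝 (if z = ∞ then 0 else 1)) := by
  have h : (fun x => expNeg (x * z)) =ᶠ[𝓝[>] 0] fun x => expKernel c₁ c₂ x z := by
    filter_upwards [eventually_nhdsGT_zero] with x hx using (expKernel_of_left hx.1 hx.2 z).symm
  refine Tendsto.congr' h ?_
  split_ifs with hz
  · subst hz
    refine tendsto_const_nhds.congr' ?_
    filter_upwards [eventually_nhdsGT_zero] with x hx
    simp [ENNReal.mul_top hx.1]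
  · have : Tendsto (fun x => expNeg (x * z)) (𝓝 0) (𝓝 (expNeg (0 * z))) :=
      (continuous_expNeg.comp (ENNReal.continuous_mul_const hz)).tendsto 0
    simpa using this.mono_left nhdsWithin_le_nhds

lemma tendsto_expKernel_top (z : ℝ≥0∞) :
    Tendsto (fun x => expKernel c₁ c₂ x z) (𝓝[<] ∞) (𝓝 (if z = 0 then 1 else 0)) := by
  have h : (fun x => expNeg (x * z)) =ᶠ[𝓝[<] ∞] fun x => expKernel c₁ c₂ x z := by
    filter_upwards [eventually_nhdsLT_top] with x hx using (expKernel_of_left hx.1 hx.2 z).symm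
  refine Tendsto.congr' h ?_
  split_ifs with hz
  · subst hz; simp
  · have h1 : Tendsto (fun x => x * z) (𝓝 ∞) (𝓝 (∞ * z)) :=
      ENNReal.Tendsto.mul_const tendsto_id (Or.inl (by simp))
    have : Tendsto (fun x => expNeg (x * z)) (𝓝 ∞) (𝓝 (expNeg (∞ * z))) :=
      (continuous_expNeg.tendsto _).comp h1
    rw [ENNReal.top_mul hz, expNeg_top] at this
    exact this.mono_left nhdsWithin_le_nhds

lemma integral_ite_eq_zero_one (μ : Measure ℝ≥0∞) [IsFiniteMeasure μ] (a : ℝ≥0∞) :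
    ∫ z, (if z = a then 0 else 1 : ℝ) ∂μ = μ.real univ - μ.real {a} := by
  have : (fun z => if z = a then 0 else 1 : ℝ≥0∞ → ℝ)
      = fun z => 1 - ({a} : Set ℝ≥0∞).indicator (fun _ => (1 : ℝ)) z := by
    ext z; by_cases h : z = a <;> simp [h]
  rw [this, integral_sub (integrable_const _)
    ((integrable_const _).indicator (measurableSet_singleton a)),
    integral_indicator_const _ (measurableSet_singleton a)]
  simp

lemma integral_ite_eq_one_zero (μ : Measure ℝ≥0∞) (a : ℝ≥0∞) :
    ∫ z, (if z = a then 1 else 0 : ℝ) ∂μ = μ.real {a} := by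
  have : (fun z => if z = a then 1 else 0 : ℝ≥0∞ → ℝ)
      = ({a} : Set ℝ≥0∞).indicator (fun _ => (1 : ℝ)) := by
    ext z; by_cases h : z = a <;> simp [h]
  rw [this, integral_indicator_const _ (measurableSet_singleton a)]
  simp

lemma boundary_integral_expKernel_zero (q : Measure ℝ≥0∞) [IsProbabilityMeasure q] :
    c₁.Boundary fun x => ∫ z, expKernel c₁ c₂ x z ∂q := by
  cases c₁
  · refine tendsto_integral_expKernel q fun z => ?_
    rw [expKernel_zero_left_zeroPlus]
    exact tendsto_expKernel_zero z
  · simp [ZeroTimesTop.Boundary, expKernel_zero_left_topMinus]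

lemma boundary_integral_expKernel_top (q : Measure ℝ≥0∞) [IsProbabilityMeasure q] :
    c₂.Boundary fun x => ∫ z, expKernel c₁ c₂ x z ∂q := by
  cases c₂
  · simp [TopTimesZero.Boundary, expKernel_top_left_zeroPlus]
  · refine tendsto_integral_expKernel q fun z => ?_
    rw [expKernel_top_left_topMinus]
    exact tendsto_expKernel_top z

/-- A completely monotone function bounded by `1` with the right behaviour at `0` and `∞` is the
Laplace transform, on all of `[0, ∞]`, of a probability measure on `[0, ∞]`. -/
theorem IsAlternating.exists_probabilityMeasure {f : ℝ≥0∞ → ℝ} (hf : IsAlternating f)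
    (h1 : f 0 ≤ 1) (hb₁ : c₁.Boundary f) (hb₂ : c₂.Boundary f) :
    ∃ q : Measure ℝ≥0∞, IsProbabilityMeasure q ∧ ∀ x, f x = ∫ z, expKernel c₁ c₂ x z ∂q := by
  obtain ⟨μ, hμ, hfμ⟩ := hf.exists_expKernel
  have hfin : IsFiniteMeasure μ := ⟨by simp [hμ]⟩
  have h0 : 0 ≤ f ∞ := hf.nonneg ∞
  have h0' : f ∞ ≤ f 0 := hf.antitone le_top
  have hμr : μ.real univ = f 0 - f ∞ := by simp [measureReal_def, hμ, h0']
  set q : Measure ℝ≥0∞ := μ + (ENNReal.ofReal (f ∞) • Measure.dirac 0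
    + ENNReal.ofReal (1 - f 0) • Measure.dirac ∞) with hq
  have hqp : IsProbabilityMeasure q := by
    constructor
    rw [hq, Measure.add_apply, Measure.add_apply, hμ]
    simp only [Measure.smul_apply, measure_univ, smul_eq_mul, mul_one]
    rw [← ENNReal.ofReal_add h0 (by linarith), ← ENNReal.ofReal_one]
    change ENNReal.ofReal (f 0 - f ∞) + _ = _
    rw [← ENNReal.ofReal_add (by linarith) (by linarith)]
    congr 1; ring
  have hint : ∀ x, ∫ z, expKernel c₁ c₂ x z ∂q = ∫ z, expKernel c₁ c₂ x z ∂μ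
      + (f ∞ * expKernel c₁ c₂ x 0 + (1 - f 0) * expKernel c₁ c₂ x ∞) := fun x => by
    rw [hq, integral_add_measure (integrable_expKernel_right _ x), integral_add_measure,
      integral_smul_measure, integral_smul_measure, integral_dirac, integral_dirac,
      ENNReal.toReal_ofReal h0, ENNReal.toReal_ofReal (by linarith), smul_eq_mul, smul_eq_mul]
    · exact (integrable_expKernel_right _ x).smul_measure ENNReal.ofReal_ne_top
    · exact (integrable_expKernel_right _ x).smul_measure ENNReal.ofReal_ne_top
    · exact ((integrable_expKernel_right _ x).smul_measure ENNReal.ofReal_ne_top).add_measure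
        ((integrable_expKernel_right _ x).smul_measure ENNReal.ofReal_ne_top)
  refine ⟨q, hqp, fun x => ?_⟩
  rw [hint]
  rcases eq_or_ne x 0 with rfl | hx0
  · cases c₁
    · have hl : Tendsto f (𝓝[>] 0) (𝓝 (μ.real univ - μ.real {∞} + f ∞)) := by
        rw [← integral_ite_eq_zero_one]
        exact ((tendsto_integral_expKernel μ tendsto_expKernel_zero).add_const (f ∞)).congr
          fun x => (hfμ x).symm
      have := tendsto_nhds_unique hb₁ hl
      simp only [expKernel_zero_left_zeroPlus, integral_ite_eq_zero_one]
      simp only [if_true, ENNReal.zero_ne_top, if_false]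
      linarith
    · have : f 0 = 1 := hb₁
      simp only [expKernel_zero_left_topMinus]
      simp [hμr]
      linarith
  rcases eq_or_ne x ∞ with rfl | hxt
  · cases c₂
    · have : f ∞ = 0 := hb₂
      simp [expKernel_top_left_zeroPlus, this]
    · have hl : Tendsto f (𝓝[<] ∞) (𝓝 (μ.real {0} + f ∞)) := by
        rw [← integral_ite_eq_one_zero]
        exact ((tendsto_integral_expKernel μ tendsto_expKernel_top).add_const (f ∞)).congr
          fun x => (hfμ x).symm
      have := tendsto_nhds_unique hb₂ hl
      simp only [expKernel_top_left_topMinus, integral_ite_eq_one_zero]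
      simp only [if_true, ENNReal.top_ne_zero, if_false]
      linarith
  · rw [hfμ]
    simp [expKernel_of_left hx0 hxt, ENNReal.mul_top hx0]

end Boundary

namespace PositiveMarkovProcess

variable {c₁ : ZeroTimesTop} {c₂ : TopTimesZero} {X : PositiveMarkovProcess.{u}}

/-- The Laplace transforms of a family of probability measures satisfying a duality relation
with `X` yield the transition semigroup of a positive Markov process. -/
theorem exists_laplaceDual {q : ℝ≥0 → ℝ≥0∞ → Measure ℝ≥0∞}
    (hq : ∀ t y, IsProbabilityMeasure (q t y))
    (h : ∀ t y x, X.semigroup t (fun u => expKernel c₁ c₂ u y) x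
      = ∫ z, expKernel c₁ c₂ x z ∂(q t y)) :
    ∃ Y : PositiveMarkovProcess.{v}, X.LaplaceDual c₁ c₂ Y := by
  have hext : ∀ μ ν : Measure ℝ≥0∞, IsProbabilityMeasure μ → IsProbabilityMeasure ν →
      (∀ x, x ≠ 0 → x ≠ ∞ → ∫ z, expKernel c₁ c₂ x z ∂μ = ∫ z, expKernel c₁ c₂ x z ∂ν) →
      μ = ν := by
    intro μ ν _ _ H
    refine measure_ext_of_expNeg fun x hx => ?_
    rcases eq_or_ne x 0 with rfl | hx0
    · simp
    · simpa [expKernel_of_left hx0 hx, mul_comm] using H x hx0 hx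
  have hmeas : ∀ t, Measurable (q t) := by
    intro t
    refine measurable_of_measurable_expNeg fun x hx => ?_
    rcases eq_or_ne x 0 with rfl | hx0
    · simp
    have : (fun y => ∫ z, expNeg (z * x) ∂(q t y))
        = fun y => ∫ u, expKernel c₁ c₂ u y ∂(X.trans t x) := by
      funext y
      have := h t y x
      simp only [expKernel_of_left hx0 hx] at this
      simp only [mul_comm _ x]
      exact this.symm
    rw [this]
    exact (measurable_expKernel c₁ c₂).stronglyMeasurable.integral_prod_left'.measurable
  let κ : ℝ≥0 → Kernel ℝ≥0∞ ℝ≥0∞ := fun t => ⟨q t, hmeas t⟩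
  have hκ : ∀ t, IsMarkovKernel (κ t) := fun t => ⟨hq t⟩
  have hzero : ∀ y, q 0 y = Measure.dirac y := by
    intro y
    refine hext _ _ (hq 0 y) inferInstance fun x _ _ => ?_
    rw [← h, semigroup, X.trans_zero, integral_dirac, integral_dirac]
  have hadd : ∀ s t y, q (s + t) y = (q s y).bind (q t) := by
    intro s t y
    have hprob : IsProbabilityMeasure ((q s y).bind (q t)) :=
      isProbabilityMeasure_bind (hmeas t).aemeasurable (.of_forall (hq t))
    refine hext _ _ (hq _ y) hprob fun x hx0 hx => ?_
    have hint : Integrable (fun p : ℝ≥0∞ × ℝ≥0∞ => expKernel c₁ c₂ p.2 p.1)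
        ((q s y).prod (X.trans t x)) :=
      .of_bound ((measurable_expKernel _ _).comp measurable_swap).aestronglyMeasurable 1
        (.of_forall fun p => norm_expKernel_le _ _)
    calc ∫ z, expKernel c₁ c₂ x z ∂(q (s + t) y)
        = X.semigroup (t + s) (fun u => expKernel c₁ c₂ u y) x := by rw [h, add_comm]
      _ = X.semigroup t (X.semigroup s fun u => expKernel c₁ c₂ u y) x :=
          X.semigroup_add s t x (integrable_expKernel_left _ y)
      _ = ∫ u, ∫ w, expKernel c₁ c₂ u w ∂(q s y) ∂(X.trans t x) := by
          rw [semigroup]; exact integral_congr_ae (.of_forall fun u => h s y u)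
      _ = ∫ w, ∫ u, expKernel c₁ c₂ u w ∂(X.trans t x) ∂(q s y) :=
          (integral_integral_swap hint).symm
      _ = ∫ w, ∫ z, expKernel c₁ c₂ x z ∂(q t w) ∂(q s y) :=
          integral_congr_ae (.of_forall fun w => h t w x)
      _ = ∫ z, expKernel c₁ c₂ x z ∂((q s y).bind (q t)) :=
          (integral_bind_kernel (q s y) (κ t) (integrable_expKernel_right _ x)).symm
  let S : MarkovSemigroup ℝ≥0∞ :=
    { kernel := κ
      isMarkovKernel := hκ
      kernel_zero := by
        ext1 y
        rw [Kernel.id_apply]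
        exact hzero y
      lintegral_add := fun s t y g hg => by
        change ∫⁻ z, g z ∂(q (s + t) y) = ∫⁻ w, ∫⁻ z, g z ∂(q t w) ∂(q s y)
        rw [hadd, Measure.lintegral_bind (hmeas t).aemeasurable hg.aemeasurable] }
  refine ⟨S.process, laplaceDual_iff.2 fun t x y => ?_⟩
  rw [S.process_trans]
  exact h t y x

/-- Existence of a Laplace dual in terms of the images of the exponentials. -/
theorem exists_laplaceDual_iff : (∃ Y : PositiveMarkovProcess.{v}, X.LaplaceDual c₁ c₂ Y) ↔
    X.CompletelyMonotone ∧
      (∀ t y, c₁.Boundary (X.semigroup t fun u => expKernel c₁ c₂ u y)) ∧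
      ∀ t y, c₂.Boundary (X.semigroup t fun u => expKernel c₁ c₂ u y) := by
  constructor
  · rintro ⟨Y, h⟩
    have heq : ∀ t y, X.semigroup t (fun u => expKernel c₁ c₂ u y)
        = fun x => ∫ z, expKernel c₁ c₂ x z ∂(Y.trans t y) :=
      fun t y => funext fun x => laplaceDual_iff.1 h t x y
    refine ⟨h.completelyMonotone, fun t y => ?_, fun t y => ?_⟩
    · rw [heq]; exact boundary_integral_expKernel_zero _
    · rw [heq]; exact boundary_integral_expKernel_top _
  · rintro ⟨hcm, hb₁, hb₂⟩
    have hle : ∀ t y, X.semigroup t (fun u => expKernel c₁ c₂ u y) 0 ≤ 1 := fun t y =>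
      (integral_mono (integrable_expKernel_left _ y) (integrable_const 1)
        fun u => expKernel_le_one u y).trans_eq (by simp)
    choose q hq hqf using fun t y =>
      (hcm t _ (isCM_expKernel_left y)).isAlternating.exists_probabilityMeasure (hle t y)
        (hb₁ t y) (hb₂ t y)
    exact exists_laplaceDual hq hqf

end PositiveMarkovProcess

namespace PositiveMarkovProcess

section BoundaryProperties

variable {c₁ : ZeroTimesTop} {c₂ : TopTimesZero} {X : PositiveMarkovProcess.{u}}

lemma absorbing_iff {x : ℝ≥0∞} : X.Absorbing x ↔ ∀ t, (X.trans t x).real {x} = 1 := by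
  refine forall_congr' fun t => ⟨fun h => by simp [h, measureReal_def], fun h => ?_⟩
  have hae : ∀ᵐ u ∂(X.trans t x), u = x := by
    rw [ae_iff]
    have h1 : X.trans t x {x} = 1 := by
      rw [← ENNReal.toReal_eq_one_iff]; exact h
    exact (prob_compl_eq_zero_iff (measurableSet_singleton x)).2 h1
  rw [← Measure.map_id (μ := X.trans t x), Measure.map_congr (f := id) (g := fun _ => x) hae,
    Measure.map_const]
  simp

lemma semigroup_ite_eq_one_zero (t : ℝ≥0) (a x : ℝ≥0∞) :
    X.semigroup t (fun u => if u = a then 1 else 0) x = (X.trans t x).real {a} :=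
  integral_ite_eq_one_zero _ a

lemma semigroup_ite_eq_zero_one (t : ℝ≥0) (a x : ℝ≥0∞) :
    X.semigroup t (fun u => if u = a then 0 else 1) x = 1 - (X.trans t x).real {a} := by
  rw [semigroup, integral_ite_eq_zero_one]; simp

lemma semigroup_const (t : ℝ≥0) (c : ℝ) : X.semigroup t (fun _ => c) = fun _ => c := by
  ext; simp [semigroup]

lemma forall_boundary_topMinus_iff :
    (∀ t y, ZeroTimesTop.topMinus.Boundary
      (X.semigroup t fun u => expKernel .topMinus c₂ u y)) ↔ X.Absorbing 0 := by
  simp only [ZeroTimesTop.Boundary]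
  refine ⟨fun h => absorbing_iff.2 fun t => ?_, fun h t y => ?_⟩
  · simpa only [expKernel_top_right_topMinus, semigroup_ite_eq_one_zero] using h t ∞
  · rw [semigroup, h t, integral_dirac, expKernel_zero_left_topMinus]

lemma forall_boundary_zeroPlus_iff :
    (∀ t y, TopTimesZero.zeroPlus.Boundary
      (X.semigroup t fun u => expKernel c₁ .zeroPlus u y)) ↔ X.Absorbing ∞ := by
  simp only [TopTimesZero.Boundary]
  refine ⟨fun h => absorbing_iff.2 fun t => ?_, fun h t y => ?_⟩
  · have := h t 0
    simp only [expKernel_zero_right_zeroPlus, semigroup_ite_eq_zero_one] at this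
    linarith
  · rw [semigroup, h t, integral_dirac, expKernel_top_left_zeroPlus]

lemma setIntegral_comp_X (t : ℝ≥0) (x : ℝ≥0∞) {B : Set ℝ≥0∞} (hB : MeasurableSet B)
    {f : ℝ≥0∞ → ℝ} (hf : Measurable f) :
    ∫ ω in {ω | X.X t ω ∈ B}, f (X.X t ω) ∂(X.P x) = ∫ u in B, f u ∂(X.trans t x) :=
  (setIntegral_map hB hf.aestronglyMeasurable (X.measurable_X t).aemeasurable).symm

lemma setIntegral_expNeg_ne_top (t : ℝ≥0) (x y : ℝ≥0∞) (hy : y ≠ ∞) :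
    ∫ u in Iio ∞, expNeg (u * y) ∂(X.trans t x)
      = X.semigroup t (fun u => expKernel .zeroPlus .zeroPlus u y) x := by
  rw [← integral_indicator measurableSet_Iio, semigroup]
  refine integral_congr_ae (.of_forall fun u => ?_)
  rcases eq_or_ne u ∞ with rfl | hu
  · simp [expKernel_top_left_zeroPlus]
  · simp only
    rw [indicator_of_mem (mem_Iio.2 (lt_top_iff_ne_top.2 hu)), expKernel_of_ne_top hu hy]

lemma setIntegral_expNeg_ne_zero (t : ℝ≥0) (x y : ℝ≥0∞) (hy : y ≠ ∞) :
    ∫ u in Ioi 0, expNeg (u * y) ∂(X.trans t x)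
      = X.semigroup t (fun u => expKernel .topMinus .topMinus u y) x
        - X.semigroup t (fun u => expKernel .topMinus .topMinus u ∞) x := by
  rw [← integral_indicator measurableSet_Ioi, semigroup, semigroup,
    ← integral_sub (integrable_expKernel_left _ _) (integrable_expKernel_left _ _)]
  refine integral_congr_ae (.of_forall fun u => ?_)
  simp only [expKernel_top_right_topMinus]
  rcases eq_or_ne u 0 with rfl | hu
  · simp [expKernel_zero_left_topMinus]
  · rw [indicator_of_mem (mem_Ioi.2 (pos_iff_ne_zero.2 hu)), if_neg hu, sub_zero]
    rcases eq_or_ne y 0 with rfl | hy0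
    · simp [expKernel_zero_right_topMinus]
    · rw [expKernel_of_right hy0 hy]

lemma weaklyContinuousAtZero_iff : X.WeaklyContinuousAtZero ↔
    ∀ t y, ZeroTimesTop.zeroPlus.Boundary
      (X.semigroup t fun u => expKernel .zeroPlus .zeroPlus u y) := by
  have hset : ∀ t x (f : ℝ≥0∞ → ℝ), Continuous f →
      ∫ ω in {ω | X.X t ω < ∞}, f (X.X t ω) ∂(X.P x) = ∫ u in Iio ∞, f u ∂(X.trans t x) :=
    fun t x f hf => setIntegral_comp_X t x measurableSet_Iio hf.measurable
  refine ⟨fun h t y => ?_, fun h t f hf => ?_⟩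
  · rcases eq_or_ne y ∞ with rfl | hy
    · simp [ZeroTimesTop.Boundary, expKernel_top_right_zeroPlus, semigroup_const]
    · have hc : Continuous fun u => expNeg (u * y) :=
        continuous_expNeg.comp (ENNReal.continuous_mul_const hy)
      have := h t _ hc
      simp only [hset t _ _ hc, setIntegral_expNeg_ne_top t _ y hy] at this
      exact this
  · simp only [hset t _ f hf]
    refine tendsto_integral_of_tendsto_expNeg (C := 1) (fun x => by
      rw [measureReal_restrict_apply_univ]; exact measureReal_le_one)
      (fun y hy => ?_) hf
    simp only [setIntegral_expNeg_ne_top t _ y hy]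
    exact h t y

lemma weaklyContinuousAtTop_iff : X.WeaklyContinuousAtTop ↔
    ∀ t y, TopTimesZero.topMinus.Boundary
      (X.semigroup t fun u => expKernel .topMinus .topMinus u y) := by
  have hset : ∀ t x (f : ℝ≥0∞ → ℝ), Continuous f →
      ∫ ω in {ω | 0 < X.X t ω}, f (X.X t ω) ∂(X.P x) = ∫ u in Ioi 0, f u ∂(X.trans t x) :=
    fun t x f hf => setIntegral_comp_X t x measurableSet_Ioi hf.measurable
  refine ⟨fun h t => ?_, fun h t f hf => ?_⟩
  · have hy : ∀ y, y ≠ ∞ → TopTimesZero.topMinus.Boundary fun x =>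
        X.semigroup t (fun u => expKernel .topMinus .topMinus u y) x
        - X.semigroup t (fun u => expKernel .topMinus .topMinus u ∞) x := fun y hy => by
      have hc : Continuous fun u => expNeg (u * y) :=
        continuous_expNeg.comp (ENNReal.continuous_mul_const hy)
      have := h t _ hc
      simp only [hset t _ _ hc, setIntegral_expNeg_ne_zero t _ y hy] at this
      exact this
    have htop : TopTimesZero.topMinus.Boundary
        (X.semigroup t fun u => expKernel .topMinus .topMinus u ∞) := by
      have := hy 0 (by simp)
      simp only [TopTimesZero.Boundary, expKernel_zero_right_topMinus, semigroup_const] at this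
      simpa [TopTimesZero.Boundary] using this.const_sub 1
    intro y
    rcases eq_or_ne y ∞ with rfl | hyt
    · exact htop
    · have := (hy y hyt).add htop
      simpa [TopTimesZero.Boundary] using this
  · simp only [hset t _ f hf]
    refine tendsto_integral_of_tendsto_expNeg (C := 1) (fun x => by
      rw [measureReal_restrict_apply_univ]; exact measureReal_le_one)
      (fun y hy => ?_) hf
    simp only [setIntegral_expNeg_ne_zero t _ y hy]
    exact (h t y).sub (h t ∞)

lemma weaklyContinuousAt_iff {a : ℝ≥0∞} : X.WeaklyContinuousAt a ↔
    ∀ t y, Tendsto (X.semigroup t fun u => expKernel .zeroPlus .topMinus u y) (𝓝[≠] a)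
      (𝓝 (X.semigroup t (fun u => expKernel .zeroPlus .topMinus u y) a)) := by
  have hker : ∀ y, y ≠ ∞ → (fun u => expKernel .zeroPlus .topMinus u y)
      = fun u => expNeg (u * y) := fun y hy => by
    funext u
    rcases eq_or_ne y 0 with rfl | hy0
    · simp [expKernel_zero_right_topMinus]
    · rw [expKernel_of_right hy0 hy]
  refine ⟨fun h t y => ?_, fun h t f hf => ?_⟩
  · rcases eq_or_ne y ∞ with rfl | hy
    · simp [expKernel_top_right_zeroPlus, semigroup_const]
    · rw [hker y hy]
      exact continuousAt_iff_punctured_nhds.1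
        (h t _ (continuous_expNeg.comp (ENNReal.continuous_mul_const hy)))
  · refine continuousAt_iff_punctured_nhds.2 ?_
    refine tendsto_integral_of_tendsto_expNeg (C := 1) (fun x => measureReal_le_one)
      (fun y hy => ?_) hf
    have := h t y
    rw [hker y hy] at this
    exact this

lemma weaklyContinuousAt_zero_iff : X.WeaklyContinuousAt 0 ↔
    ∀ t y, ZeroTimesTop.zeroPlus.Boundary
      (X.semigroup t fun u => expKernel .zeroPlus .topMinus u y) := by
  have : ({0}ᶜ : Set ℝ≥0∞) = Ioi 0 := by ext; simp [pos_iff_ne_zero]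
  rw [weaklyContinuousAt_iff, this]
  rfl

lemma weaklyContinuousAt_top_iff : X.WeaklyContinuousAt ∞ ↔
    ∀ t y, TopTimesZero.topMinus.Boundary
      (X.semigroup t fun u => expKernel .zeroPlus .topMinus u y) := by
  have : ({∞}ᶜ : Set ℝ≥0∞) = Iio ∞ := by ext; simp [lt_top_iff_ne_top]
  rw [weaklyContinuousAt_iff, this]
  rfl

end BoundaryProperties

section Dual

variable {X : PositiveMarkovProcess.{u}}

theorem exists_laplaceDual_zeroPlus_zeroPlus_iff :
    (∃ Y : PositiveMarkovProcess.{v}, X.LaplaceDual .zeroPlus .zeroPlus Y) ↔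
      X.CompletelyMonotone ∧ X.WeaklyContinuousAtZero ∧ X.Absorbing ∞ := by
  rw [exists_laplaceDual_iff, forall_boundary_zeroPlus_iff, weaklyContinuousAtZero_iff]

theorem exists_laplaceDual_topMinus_topMinus_iff :
    (∃ Y : PositiveMarkovProcess.{v}, X.LaplaceDual .topMinus .topMinus Y) ↔
      X.CompletelyMonotone ∧ X.WeaklyContinuousAtTop ∧ X.Absorbing 0 := by
  rw [exists_laplaceDual_iff, forall_boundary_topMinus_iff, weaklyContinuousAtTop_iff,
    and_comm (a := X.Absorbing 0)]

theorem exists_laplaceDual_topMinus_zeroPlus_iff :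
    (∃ Y : PositiveMarkovProcess.{v}, X.LaplaceDual .topMinus .zeroPlus Y) ↔
      X.CompletelyMonotone ∧ X.Absorbing 0 ∧ X.Absorbing ∞ := by
  rw [exists_laplaceDual_iff, forall_boundary_topMinus_iff, forall_boundary_zeroPlus_iff]

theorem exists_laplaceDual_zeroPlus_topMinus_iff :
    (∃ Y : PositiveMarkovProcess.{v}, X.LaplaceDual .zeroPlus .topMinus Y) ↔
      X.CompletelyMonotone ∧ X.WeaklyContinuousAt 0 ∧ X.WeaklyContinuousAt ∞ := by
  rw [exists_laplaceDual_iff, weaklyContinuousAt_zero_iff, weaklyContinuousAt_top_iff]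

variable {c₁ : ZeroTimesTop} {c₂ : TopTimesZero} {Y : PositiveMarkovProcess.{v}}

lemma integral_ite_eq_one_zero_comp_X (t : ℝ≥0) (a x : ℝ≥0∞) :
    ∫ ω, (if X.X t ω = a then 1 else 0 : ℝ) ∂(X.P x) = (X.P x).real {ω | X.X t ω = a} := by
  rw [X.integral_comp_X t x (g := fun u => if u = a then 1 else 0)
    (Measurable.ite (measurableSet_singleton a) measurable_const measurable_const),
    semigroup_ite_eq_one_zero, measureReal_def, X.trans_apply t x (measurableSet_singleton a)]
  rfl

lemma integral_ite_eq_top_zero_one_comp_X (t : ℝ≥0) (x : ℝ≥0∞) :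
    ∫ ω, (if X.X t ω = ∞ then 0 else 1 : ℝ) ∂(X.P x) = (X.P x).real {ω | X.X t ω < ∞} := by
  rw [X.integral_comp_X t x (g := fun u => if u = ∞ then 0 else 1)
    (Measurable.ite (measurableSet_singleton _) measurable_const measurable_const),
    semigroup_ite_eq_zero_one, ← probReal_compl_eq_one_sub (measurableSet_singleton _),
    measureReal_def, X.trans_apply t x (measurableSet_singleton _).compl]
  simp [measureReal_def, lt_top_iff_ne_top, preimage, Set.compl_def]

namespace LaplaceDual

lemma integral_zero_eq (h : X.LaplaceDual .zeroPlus c₂ Y) (t : ℝ≥0) (y : ℝ≥0∞) :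
    ∫ ω, expKernel .zeroPlus c₂ (X.X t ω) y ∂(X.P 0) = (Y.P y).real {ω | Y.X t ω < ∞} := by
  rw [h t 0 y, ← integral_ite_eq_top_zero_one_comp_X]
  simp only [expKernel_zero_left_zeroPlus]

lemma integral_top_eq (h : X.LaplaceDual c₁ .topMinus Y) (t : ℝ≥0) (y : ℝ≥0∞) :
    ∫ ω, expKernel c₁ .topMinus (X.X t ω) y ∂(X.P ∞) = (Y.P y).real {ω | Y.X t ω = 0} := by
  rw [h t ∞ y, ← integral_ite_eq_one_zero_comp_X]
  simp only [expKernel_top_left_topMinus]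

lemma real_lt_top_eq (h : X.LaplaceDual c₁ .zeroPlus Y) (t : ℝ≥0) (x : ℝ≥0∞) :
    (X.P x).real {ω | X.X t ω < ∞} = ∫ ω, expKernel c₁ .zeroPlus x (Y.X t ω) ∂(Y.P 0) := by
  rw [← h t x 0, ← integral_ite_eq_top_zero_one_comp_X]
  simp only [expKernel_zero_right_zeroPlus]

lemma real_eq_zero_eq (h : X.LaplaceDual .topMinus c₂ Y) (t : ℝ≥0) (x : ℝ≥0∞) :
    (X.P x).real {ω | X.X t ω = 0} = ∫ ω, expKernel .topMinus c₂ x (Y.X t ω) ∂(Y.P ∞) := by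
  rw [← h t x ∞, ← integral_ite_eq_one_zero_comp_X]
  simp only [expKernel_top_right_topMinus]

end LaplaceDual

end Dual

end PositiveMarkovProcess

open PositiveMarkovProcess

theorem mainTheorem1 (X : PositiveMarkovProcess.{u}) :
    -- conventions `0⁺ · ∞` and `∞ · 0⁺`
    (((∃ Y : PositiveMarkovProcess.{v}, X.LaplaceDual .zeroPlus .zeroPlus Y) ↔
        X.CompletelyMonotone ∧ X.WeaklyContinuousAtZero ∧ X.Absorbing ∞) ∧
      ∀ Y : PositiveMarkovProcess.{v}, X.LaplaceDual .zeroPlus .zeroPlus Y →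
        Y.CompletelyMonotone ∧ Y.WeaklyContinuousAtZero ∧ Y.Absorbing ∞ ∧
        ∀ (t : ℝ≥0) (x y : ℝ≥0∞),
          (∫ ω, expKernel .zeroPlus .zeroPlus (X.X t ω) y ∂(X.P 0)
            = (Y.P y).real {ω | Y.X t ω < ∞}) ∧
          ((X.P x).real {ω | X.X t ω < ∞}
            = ∫ ω, expKernel .zeroPlus .zeroPlus x (Y.X t ω) ∂(Y.P 0))) ∧
    -- conventions `0 · ∞⁻` and `∞⁻ · 0`
    (((∃ Y : PositiveMarkovProcess.{v}, X.LaplaceDual .topMinus .topMinus Y) ↔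
        X.CompletelyMonotone ∧ X.WeaklyContinuousAtTop ∧ X.Absorbing 0) ∧
      ∀ Y : PositiveMarkovProcess.{v}, X.LaplaceDual .topMinus .topMinus Y →
        Y.CompletelyMonotone ∧ Y.WeaklyContinuousAtTop ∧ Y.Absorbing 0 ∧
        ∀ (t : ℝ≥0) (x y : ℝ≥0∞),
          (∫ ω, expKernel .topMinus .topMinus (X.X t ω) y ∂(X.P ∞)
            = (Y.P y).real {ω | Y.X t ω = 0}) ∧
          ((X.P x).real {ω | X.X t ω = 0}
            = ∫ ω, expKernel .topMinus .topMinus x (Y.X t ω) ∂(Y.P ∞))) ∧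
    -- conventions `0 · ∞⁻` and `∞ · 0⁺`
    (((∃ Y : PositiveMarkovProcess.{v}, X.LaplaceDual .topMinus .zeroPlus Y) ↔
        X.CompletelyMonotone ∧ X.Absorbing 0 ∧ X.Absorbing ∞) ∧
      ∀ Y : PositiveMarkovProcess.{v}, X.LaplaceDual .topMinus .zeroPlus Y →
        Y.CompletelyMonotone ∧ Y.WeaklyContinuousAt 0 ∧ Y.WeaklyContinuousAt ∞ ∧
        ∀ (t : ℝ≥0) (x : ℝ≥0∞),
          ((X.P x).real {ω | X.X t ω < ∞}
            = ∫ ω, expKernel .topMinus .zeroPlus x (Y.X t ω) ∂(Y.P 0)) ∧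
          ((X.P x).real {ω | X.X t ω = 0}
            = ∫ ω, expKernel .topMinus .zeroPlus x (Y.X t ω) ∂(Y.P ∞))) ∧
    -- conventions `0⁺ · ∞` and `∞⁻ · 0`
    (((∃ Y : PositiveMarkovProcess.{v}, X.LaplaceDual .zeroPlus .topMinus Y) ↔
        X.CompletelyMonotone ∧ X.WeaklyContinuousAt 0 ∧ X.WeaklyContinuousAt ∞) ∧
      ∀ Y : PositiveMarkovProcess.{v}, X.LaplaceDual .zeroPlus .topMinus Y →
        Y.CompletelyMonotone ∧ Y.Absorbing 0 ∧ Y.Absorbing ∞ ∧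
        ∀ (t : ℝ≥0) (y : ℝ≥0∞),
          (∫ ω, expKernel .zeroPlus .topMinus (X.X t ω) y ∂(X.P 0)
            = (Y.P y).real {ω | Y.X t ω < ∞}) ∧
          (∫ ω, expKernel .zeroPlus .topMinus (X.X t ω) y ∂(X.P ∞)
            = (Y.P y).real {ω | Y.X t ω = 0})) := by

  refine ⟨⟨exists_laplaceDual_zeroPlus_zeroPlus_iff, fun Y h => ?_⟩,
    ⟨exists_laplaceDual_topMinus_topMinus_iff, fun Y h => ?_⟩,
    ⟨exists_laplaceDual_topMinus_zeroPlus_iff, fun Y h => ?_⟩,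
    ⟨exists_laplaceDual_zeroPlus_topMinus_iff, fun Y h => ?_⟩⟩
  · obtain ⟨h1, h2, h3⟩ := exists_laplaceDual_zeroPlus_zeroPlus_iff.1 ⟨X, h.symm⟩
    exact ⟨h1, h2, h3, fun t x y => ⟨h.integral_zero_eq t y, h.real_lt_top_eq t x⟩⟩
  · obtain ⟨h1, h2, h3⟩ := exists_laplaceDual_topMinus_topMinus_iff.1 ⟨X, h.symm⟩
    exact ⟨h1, h2, h3, fun t x y => ⟨h.integral_top_eq t y, h.real_eq_zero_eq t x⟩⟩
  · obtain ⟨h1, h2, h3⟩ := exists_laplaceDual_zeroPlus_topMinus_iff.1 ⟨X, h.symm⟩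
    exact ⟨h1, h2, h3, fun t x => ⟨h.real_lt_top_eq t x, h.real_eq_zero_eq t x⟩⟩
  · obtain ⟨h1, h2, h3⟩ := exists_laplaceDual_topMinus_zeroPlus_iff.1 ⟨X, h.symm⟩
    exact ⟨h1, h2, h3, fun t y => ⟨h.integral_zero_eq t y, h.integral_top_eq t y⟩⟩
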